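/- **Setting.** Let $p,n,n',p'$ be dimensions and sample sizes and let $(\mathbf X_i,\mathbf Z_i)$, $i=1,\dots,n$, be i.i.d. with values in $\mathbb R^2\times\mathbb R^p$ and with joint Lebesgue density $f$; write $f_{\mathbf Z}(\mathbf z)=\int f(\mathbf x,\mathbf z)\,d\mathbf x$. Let $\mathcal Z\subset\mathbb R^p$ be compact. For $\mathbf z \in\mathcal Z$ the conditional Kendall's tau is $$\tau(\mathbf z)=P\big((x_{1,1}-x_{2,1})(x_{1,2}-x_{2,2})>0\big)-P\big((x_{1,1}-x_{2,1})(x_{1,2}-x_{2,2})<0\big),$$ where $\mathbf x_1,\mathbf x_2$ are independent with density $f(\cdot,\mathbf z)/f_{\mathbf Z}(\mathbf z)$. With a kernel $K:\mathbb R^p\to\mathbb R$, a bandwidth $h$ and $K_h(\mathbf u)=h^{-p}K(\mathbf u/h)$ put $$w_i(\mathbf z)=\frac{K_h(\mathbf Z_i-\mathbf z)}{\sum_{j=1}^nK_h(\mathbf Z_j-\mathbf z)},\qquad \hat\tau(\mathbf z)=\sum_{i,j=1}^n w_i(\mathbf z)w_j(\mathbf z)\,g(\mathbf X_i,\mathbf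 X_j),$$ where $g$ is any one of $g_1(\mathbf x,\mathbf y)=4\cdot\mathbf 1\{x_1<y_1,x_2<y_2\}-1$, $g_2(\mathbf x,\mathbf y)=\operatorname{sign}\big((x_1-y_1)(x_2-y_2)\big)$, $g_3(\mathbf x,\mathbf y)=1-4\cdot\mathbf 1\{x_1<y_1,x_2>y_2\}$. **Assumptions.** 1. $K$ is bounded with $C_K:=\|K\|_\infty$, symmetric ($K(-\mathbf u)=K(\mathbf u)$), integrable with $\int K=1$, and of order $\alpha$ for an integer $\alpha>1$: for $1\le j\le\alpha-1$ all moments $\int K(\mathbf u)u_{i_1}\cdots u_{i_j}\,d\mathbf u$ exist and vanish. 2. $f_{\mathbf Z}$ is $\alpha$ times continuously differentiable and, with a constant $C_{K,\alpha}>0$, for all $\mathbf z\in\mathcal Z$, $$\int|K|(\mathbf u)\sum_{i_1,\dots,i_\alpha=1}^p|u_{i_1}\cdots u_{i_\alpha}|\sup_{r\in[0,1]}\Big|\frac{\partial^\alpha f_{\mathbf Z}}{\partial z_{i_1}\cdots\partial z_{i_\alpha}}(\mathbf z+r\mathbf u)\Big|\,d\mathbf u\le C_{K,\alpha}.$$ 3.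 There are constants $f_{\min},f_{\max}>0$ with $f_{\mathbf Z}\ge f_{\min}$ on $\mathcal Z$ and $f_{\mathbf Z}\le f_{\max}$ on $\mathbb R^p$. 4. For almost every $\mathbf x$ the function $\mathbf z\mapsto f(\mathbf x,\mathbf z)$ is $\alpha$ times differentiable on $\mathbb R^p$. Put $$H_{k,\iota}(\mathbf u,\mathbf v,\mathbf x_1,\mathbf x_2,\mathbf z)=\sup_{r\in[0,1]}\Big|\frac{\partial^kf}{\partial z_{i_1}\cdots\partial z_{i_k}}(\mathbf x_1,\mathbf z+r\mathbf u)\,\frac{\partial^{\alpha-k}f}{\partial z_{i_{k+1}}\cdots\partial z_{i_\alpha}}(\mathbf x_2,\mathbf z+r\mathbf v)\Big|,\qquad\iota=(i_1,\dots,i_\alpha).$$ For every $\mathbf z\in\mathcal Z$ these functions are measurable in $(\mathbf u,\mathbf v,\mathbf x_1,\mathbf x_2)$, and with a constant $C_{\mathbf{XZ},\alpha}>0$ $$\int|K|(\mathbf u)|K|(\mathbf v)\sum_{k=0}^\alpha\binom\alpha k\sum_{i_1,\dots,i_\alpha=1}^pH_{k,\iota}(\mathbf u,\mathbf v,\mathbf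 x_1,\mathbf x_2,\mathbf z)\,|u_{i_1}\cdots u_{i_k}v_{i_{k+1}}\cdots v_{i_\alpha}|\,d\mathbf u\,d\mathbf v\,d\mathbf x_1\,d\mathbf x_2\le C_{\mathbf{XZ},\alpha}.$$ 5. (Model.) $\Lambda$ is a real function, $\boldsymbol\psi:\mathbb R^p\to\mathbb R^{p'}$ and $\beta^*\in\mathbb R^{p'}$ satisfy $\Lambda(\tau(\mathbf z))=\boldsymbol\psi(\mathbf z)^T\beta^*$ for all $\mathbf z\in\mathcal Z$, and $\beta^*$ has at most $s$ non-zero components, $1\le s\le p'$. Moreover $|\psi_j(\mathbf z)|\le C_\psi$ for all $j$ and $\mathbf z\in\mathcal Z$, and $\Lambda$ is continuously differentiable with $|\Lambda'|\le C_{\Lambda'}$ on an open set $\mathcal O\subset\mathbb R$, where $C_\psi,C_{\Lambda'}>0$. 6. Fix design points $\mathbf z'_1,\dots,\mathbf z'_{n'}\in\mathcal Z$ and let $\mathbb Z'$ be the $n'\times p'$ matrix with rows $\boldsymbol\psi(\mathbf z'_i)^T$. The condition $RE(s,3)$ holds, i.e. $\kappa(s,3)>0$, where $$\kappa(s,c_0)=\min_{J\subset\{1,\dots,p'\},\,|J|\le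 s}\ \min_{\delta\ne0,\ |\delta_{J^c}|_1\le c_0|\delta_J|_1}\frac{|\mathbb Z'\delta|_2}{\sqrt{n'}\,|\delta|_2}.$$ **Tuning.** Let $\gamma\ge4$, $t>0$, $\lambda=\gamma t$, and suppose that every real number within distance $t/(C_\psi C_{\Lambda'})$ of some $\tau(\mathbf z)$, $\mathbf z\in\mathcal Z$, belongs to $\mathcal O$. Let $0<h\le1$ satisfy $$h^\alpha\le\min\Big(\frac{f_{\min}\,\alpha!}{4C_{K,\alpha}},\ \frac{f_{\min}^4\,\alpha!\,t}{8C_\psi C_{\Lambda'}(f_{\min}^2+8f_{\max}^2)C_{\mathbf{XZ},\alpha}}\Big).$$ Let $\hat\beta$ be a random vector that, almost surely whenever $\sum_jK_h(\mathbf Z_j-\mathbf z'_i)\ne0$ for all $i\le n'$ (so that all the $\hat\tau(\mathbf z'_i)$ are defined), minimizes $$\beta\mapsto\frac1{n'}\sum_{i=1}^{n'}\big(\Lambda(\hat\tau(\mathbf z'_i))-\boldsymbol\psi(\mathbf z'_i)^T\beta\big)^2+\lambda|\beta|_1$$ (elsewhere $\hat\beta$ is arbitrary, and the values of $\Lambda$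 outside $\mathcal O$ are arbitrary real numbers). **Theorem.** With $\|\mathbf v\|_{n'}=|\mathbf v|_2/\sqrt{n'}$, $$P\Big(\|\mathbb Z'(\hat\beta-\beta^*)\|_{n'}\le\frac{4(\gamma+1)t\sqrt s}{\kappa(s,3)}\ \text{ and }\ |\hat\beta-\beta^*|_q\le\frac{4^{2/q}(\gamma+1)t\,s^{1/q}}{\kappa^2(s,3)}\ \text{ for every }1\le q\le2\Big)$$ $$\ge1-2n'\exp(-nh^pC_1)-2n'\exp\Big(-\frac{(n-1)h^{2p}t^2}{C_2+C_3t}\Big),$$ where $$C_1=\frac{f_{\min}^2}{32f_{\max}\int K^2+\frac83C_Kf_{\min}},\quad C_2=\frac{\{16C_\psi C_{\Lambda'}(f_{\min}^2+8f_{\max}^2)f_{\max}\int K^2\}^2}{f_{\min}^8},\quad C_3=\frac{64}3\cdot\frac{C_\psi C_{\Lambda'}C_K^2(f_{\min}^2+8f_{\max}^2)}{f_{\min}^4}.$$ -/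

import Mathlib

open MeasureTheory ProbabilityTheory Set

/-! ### Partial derivatives, norms, restricted eigenvalues -/

/-- The partial derivative `∂ᵏ g / ∂z_{i₁} … ∂z_{iₖ}` at `z`, where `i = idx`. -/
noncomputable def partialD {p k : ℕ} (g : (Fin p → ℝ) → ℝ) (idx : Fin k → Fin p)
    (z : Fin p → ℝ) : ℝ :=
  iteratedFDeriv ℝ k g z (fun j => Pi.single (idx j) 1)

/-- `g` is `α` times differentiable on `ℝᵖ` (the last derivative need not be continuous). -/
def TimesDifferentiable {p : ℕ} (α : ℕ) (g : (Fin p → ℝ) → ℝ) : Prop :=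
  ∀ k < α, Differentiable ℝ (iteratedFDeriv ℝ k g)

/-- The norm `|v|_q = (∑ |v_i|^q)^{1/q}`. -/
noncomputable def lqNorm {m : ℕ} (q : ℝ) (v : Fin m → ℝ) : ℝ :=
  (∑ i, |v i| ^ q) ^ (1 / q)

/-- The empirical norm `|v|_2 / √m` of a vector of length `m`. -/
noncomputable def empiricalNorm {m : ℕ} (v : Fin m → ℝ) : ℝ :=
  lqNorm 2 v / Real.sqrt m

/-- The restricted eigenvalue number `κ(s, c₀)` of an `m × d` matrix. -/
noncomputable def restrictedEigenvalue {m d : ℕ} (A : Matrix (Fin m) (Fin d) ℝ)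
    (s : ℕ) (c₀ : ℝ) : ℝ :=
  sInf {r : ℝ | ∃ J : Finset (Fin d), J.card ≤ s ∧ ∃ δ : Fin d → ℝ, δ ≠ 0 ∧
    ∑ j ∈ Jᶜ, |δ j| ≤ c₀ * ∑ j ∈ J, |δ j| ∧
    r = lqNorm 2 (A.mulVec δ) / (Real.sqrt m * lqNorm 2 δ)}

/-- The condition `RE(s, c₀)`. -/
def RestrictedEigenvalueCondition {m d : ℕ} (A : Matrix (Fin m) (Fin d) ℝ)
    (s : ℕ) (c₀ : ℝ) : Prop :=
  0 < restrictedEigenvalue A s c₀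

/-- The design matrix, with rows `ψ(z'_i)ᵀ`. -/
def designMatrix {p m d : ℕ} (ψ : (Fin p → ℝ) → Fin d → ℝ) (z' : Fin m → Fin p → ℝ) :
    Matrix (Fin m) (Fin d) ℝ :=
  Matrix.of fun i j => ψ (z' i) j

/-- The Lasso criterion `(1/m) ∑ (Y_i - (A b)_i)² + λ |b|₁`. -/
noncomputable def lassoCriterion {m d : ℕ} (Y : Fin m → ℝ) (A : Matrix (Fin m) (Fin d) ℝ)
    (lam : ℝ) (b : Fin d → ℝ) : ℝ :=
  (1 / (m : ℝ)) * ∑ i, (Y i - A.mulVec b i) ^ 2 + lam * ∑ j, |b j|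

/-! ### Conditional Kendall's tau, for a joint density `f x z` of `(X, Z)` on `ℝ² × ℝᵖ` -/

/-- The marginal density `f_Z`. -/
noncomputable def marginalDensity {p : ℕ} (f : ℝ × ℝ → (Fin p → ℝ) → ℝ) (z : Fin p → ℝ) : ℝ :=
  ∫ x, f x z

/-- The conditional law of `X` given `Z = z`, with density `x ↦ f x z / f_Z z`. -/
noncomputable def conditionalLaw {p : ℕ} (f : ℝ × ℝ → (Fin p → ℝ) → ℝ) (z : Fin p → ℝ) :
    Measure (ℝ × ℝ) :=
  volume.withDensity fun x => ENNReal.ofReal (f x z / marginalDensity f z)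

/-- The conditional Kendall's tau: probability of concordance minus probability of discordance of
two independent pairs drawn from the conditional law of `X` given `Z = z`. -/
noncomputable def conditionalKendallTau {p : ℕ} (f : ℝ × ℝ → (Fin p → ℝ) → ℝ)
    (z : Fin p → ℝ) : ℝ :=
  ((conditionalLaw f z).prod (conditionalLaw f z)).real
      {w | 0 < (w.1.1 - w.2.1) * (w.1.2 - w.2.2)} -
    ((conditionalLaw f z).prod (conditionalLaw f z)).real
      {w | (w.1.1 - w.2.1) * (w.1.2 - w.2.2) < 0}

/-! ### The kernel estimator of the conditional Kendall's tau -/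

/-- The three possible choices `g₁, g₂, g₃` of the function `g*`. -/
noncomputable def gStar : Fin 3 → ℝ × ℝ → ℝ × ℝ → ℝ
  | 0, x, y => 4 * (if x.1 < y.1 ∧ x.2 < y.2 then 1 else 0) - 1
  | 1, x, y => (if 0 < (x.1 - y.1) * (x.2 - y.2) then 1 else 0) -
      (if (x.1 - y.1) * (x.2 - y.2) < 0 then 1 else 0)
  | 2, x, y => 1 - 4 * (if x.1 < y.1 ∧ y.2 < x.2 then 1 else 0)

/-- `K_h(u) = h⁻ᵖ K(u / h)`. -/
noncomputable def scaledKernel {p : ℕ} (K : (Fin p → ℝ) → ℝ) (h : ℝ) (u : Fin p → ℝ) : ℝ :=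
  (h ^ p)⁻¹ * K (h⁻¹ • u)

/-- The sum `∑_j K_h(Z_j - z)`, the denominator of the weights. -/
noncomputable def kernelSum {p n : ℕ} (K : (Fin p → ℝ) → ℝ) (h : ℝ)
    (Z : Fin n → Fin p → ℝ) (z : Fin p → ℝ) : ℝ :=
  ∑ j, scaledKernel K h (Z j - z)

/-- The weights `w_{i,n}(z) = K_h(Z_i - z) / ∑_j K_h(Z_j - z)`. -/
noncomputable def kernelWeight {p n : ℕ} (K : (Fin p → ℝ) → ℝ) (h : ℝ)
    (Z : Fin n → Fin p → ℝ) (z : Fin p → ℝ) (i : Fin n) : ℝ :=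
  scaledKernel K h (Z i - z) / kernelSum K h Z z

/-- The estimator `τ̂(z) = ∑_i ∑_j w_{i,n}(z) w_{j,n}(z) g(X_i, X_j)`. -/
noncomputable def kendallTauEstimator {p n : ℕ} (g : ℝ × ℝ → ℝ × ℝ → ℝ)
    (K : (Fin p → ℝ) → ℝ) (h : ℝ) (X : Fin n → ℝ × ℝ) (Z : Fin n → Fin p → ℝ)
    (z : Fin p → ℝ) : ℝ :=
  ∑ i, ∑ j, kernelWeight K h Z z i * kernelWeight K h Z z j * g (X i) (X j)

/-! ### The sampling model and the assumptions -/

/-- `(X_i, Z_i)`, `i = 1, …, n`, are independent with common density `f` on `ℝ² × ℝᵖ`. -/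
structure IsSampleFrom {Ω : Type*} [MeasurableSpace Ω] (μ : Measure Ω) {p n : ℕ}
    (f : ℝ × ℝ → (Fin p → ℝ) → ℝ) (X : Fin n → Ω → ℝ × ℝ) (Z : Fin n → Ω → Fin p → ℝ) :
    Prop where
  density_measurable : Measurable fun w : (ℝ × ℝ) × (Fin p → ℝ) => f w.1 w.2
  density_nonneg : ∀ x z, 0 ≤ f x z
  measurable_X : ∀ i, Measurable (X i)
  measurable_Z : ∀ i, Measurable (Z i)
  indep : iIndepFun (fun i ω => (X i ω, Z i ω)) μ
  law : ∀ i, μ.map (fun ω => (X i ω, Z i ω)) =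
    volume.withDensity fun w => ENNReal.ofReal (f w.1 w.2)

/-- `K` is a bounded, integrable, symmetric kernel of order `α` with integral one. -/
structure IsKernelOfOrder {p : ℕ} (K : (Fin p → ℝ) → ℝ) (α : ℕ) : Prop where
  measurable : Measurable K
  bounded : ∃ C, ∀ u, |K u| ≤ C
  symmetric : ∀ u, K (-u) = K u
  integrable : Integrable K
  integral_eq_one : ∫ u, K u = 1
  one_lt : 1 < α
  moment_integrable : ∀ j : ℕ, 1 ≤ j → j ≤ α - 1 → ∀ idx : Fin j → Fin p,
    Integrable fun u => K u * ∏ l, u (idx l)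
  moment_eq_zero : ∀ j : ℕ, 1 ≤ j → j ≤ α - 1 → ∀ idx : Fin j → Fin p,
    ∫ u, K u * ∏ l, u (idx l) = 0

/-- The sup-norm `‖K‖_∞` of a bounded kernel. -/
noncomputable def kernelSup {p : ℕ} (K : (Fin p → ℝ) → ℝ) : ℝ := ⨆ u, |K u|

/-- Smoothness of the marginal density `fZ`, with constant `C`. Integrals and suprema of
nonnegative quantities are taken in `[0, ∞]`. -/
structure MarginalSmoothness {p : ℕ} (K : (Fin p → ℝ) → ℝ) (α : ℕ) (fZ : (Fin p → ℝ) → ℝ)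
    (𝒵 : Set (Fin p → ℝ)) (C : ℝ) : Prop where
  contDiff : ContDiff ℝ (α : WithTop ℕ∞) fZ
  const_pos : 0 < C
  bound : ∀ z ∈ 𝒵,
    ∫⁻ u, ENNReal.ofReal |K u| * ∑ idx : Fin α → Fin p,
      ENNReal.ofReal |∏ l, u (idx l)| *
        ⨆ t ∈ Icc (0 : ℝ) 1, ENNReal.ofReal |partialD fZ idx (z + t • u)|
      ≤ ENNReal.ofReal C

/-- The first `k` of the `α` indices `idx`. -/
def headIdx {p α : ℕ} (idx : Fin α → Fin p) (k : Fin (α + 1)) : Fin k.1 → Fin p :=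
  fun j => idx ⟨j.1, by omega⟩

/-- The last `α - k` of the `α` indices `idx`. -/
def tailIdx {p α : ℕ} (idx : Fin α → Fin p) (k : Fin (α + 1)) : Fin (α - k.1) → Fin p :=
  fun j => idx ⟨k.1 + j.1, by omega⟩

/-- `H_{k,ι}(u, v, x₁, x₂, z)`, the supremum over `t ∈ [0, 1]` of
`|∂ᵏ f(x₁, z + t u) ∂^{α-k} f(x₂, z + t v)|`. -/
noncomputable def derivativeSup {p α : ℕ} (f : ℝ × ℝ → (Fin p → ℝ) → ℝ) (k : Fin (α + 1))
    (idx : Fin α → Fin p) (u v : Fin p → ℝ) (x₁ x₂ : ℝ × ℝ) (z : Fin p → ℝ) : ENNReal :=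
  ⨆ t ∈ Icc (0 : ℝ) 1, ENNReal.ofReal
    |partialD (f x₁) (headIdx idx k) (z + t • u) * partialD (f x₂) (tailIdx idx k) (z + t • v)|

/-- Smoothness of the joint density `f`, with constant `C`. The integration variable is
`w = ((u, v), (x₁, x₂))`. -/
structure JointSmoothness {p : ℕ} (K : (Fin p → ℝ) → ℝ) (α : ℕ)
    (f : ℝ × ℝ → (Fin p → ℝ) → ℝ) (𝒵 : Set (Fin p → ℝ)) (C : ℝ) : Prop where
  differentiable : ∀ᵐ x : ℝ × ℝ, TimesDifferentiable α (f x)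
  const_pos : 0 < C
  sup_aemeasurable : ∀ z ∈ 𝒵, ∀ (k : Fin (α + 1)) (idx : Fin α → Fin p),
    AEMeasurable fun w : ((Fin p → ℝ) × (Fin p → ℝ)) × ((ℝ × ℝ) × (ℝ × ℝ)) =>
      derivativeSup f k idx w.1.1 w.1.2 w.2.1 w.2.2 z
  bound : ∀ z ∈ 𝒵,
    ∫⁻ w : ((Fin p → ℝ) × (Fin p → ℝ)) × ((ℝ × ℝ) × (ℝ × ℝ)),
      ENNReal.ofReal (|K w.1.1| * |K w.1.2|) *
        ∑ k : Fin (α + 1), (α.choose k.1 : ENNReal) * ∑ idx : Fin α → Fin p,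
          derivativeSup f k idx w.1.1 w.1.2 w.2.1 w.2.2 z *
            ENNReal.ofReal
              |(∏ l, w.1.1 (headIdx idx k l)) * ∏ l, w.1.2 (tailIdx idx k l)|
      ≤ ENNReal.ofReal C

/-! ### A deterministic oracle inequality for the Lasso -/

/-! The random part of the problem is separated from the Lasso. The responses `Λ(τ̂(z'_i))` equal
the sparse linear signal plus a noise. If each empirical correlation of that noise with a regressor
is at most `t`, then a penalty `γ t` with `γ ≥ 4` forces the estimation error into the cone of
`RE(s, 3)`, and `lasso_oracle_inequality` follows with no probability involved. As `|ψ_j| ≤ Cψ` and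
`Λ` is `CΛ`-Lipschitz near `τ`, it suffices that `|τ̂ - τ| ≤ t / (Cψ CΛ)` at the `n'` design points;
a union bound over them produces the factor `n'`.

Since the weights sum to one, `τ̂(z) - τ(z)` is the double sum of `K_h K_h (g - τ(z))` divided by
the squared kernel sum. For the denominator, vanishing moments and a Taylor expansion give a bias of
at most `fmin / 4`, and Bernstein's inequality a deviation below `fmin / 4`, so the kernel sum is at
least `n fmin / 2`.

The off-diagonal part of the numerator is a `U`-statistic of order two. Hoeffding's averaging over
permutations reduces it to means of `⌊n/2⌋` independent terms (`bernstein_uStatistic`). Its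
expectation is of order `h^α` (`abs_integral_kendallSummand_le`): smoothing changes `f(x₁, z) f(x₂,
z)` by that order only, and against the unsmoothed product `g - τ(z)` integrates to zero. The latter
holds for all three `g`, because ties have probability zero and a pair of independent draws is
exchangeable (`integral_gStar`).

The diagonal part is bounded crudely, by a multiple of `1 / (n h^{2p})`. It is small enough as soon
as the second exponent exceeds `1 / 2`; otherwise the asserted lower bound on the probability is not
positive. -/

lemma lqNorm_two_eq_sqrt {m : ℕ} (v : Fin m → ℝ) : lqNorm 2 v = Real.sqrt (∑ i, v i ^ 2) := by
  unfold lqNorm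
  rw [Real.sqrt_eq_rpow]
  congr 1
  refine Finset.sum_congr rfl fun i _ => ?_
  rw [Real.rpow_two, sq_abs]

lemma lqNorm_two_nonneg {m : ℕ} (v : Fin m → ℝ) : 0 ≤ lqNorm 2 v := by
  rw [lqNorm_two_eq_sqrt]; exact Real.sqrt_nonneg _

lemma lqNorm_two_sq {m : ℕ} (v : Fin m → ℝ) : lqNorm 2 v ^ 2 = ∑ i, v i ^ 2 := by
  rw [lqNorm_two_eq_sqrt, Real.sq_sqrt (Finset.sum_nonneg fun i _ => sq_nonneg _)]

lemma lqNorm_two_pos {m : ℕ} {v : Fin m → ℝ} (hv : v ≠ 0) : 0 < lqNorm 2 v := by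
  rw [lqNorm_two_eq_sqrt]
  obtain ⟨i, hi⟩ := Function.ne_iff.1 hv
  exact Real.sqrt_pos.2 (Finset.sum_pos' (fun i _ => sq_nonneg _)
    ⟨i, Finset.mem_univ i, by have : v i ≠ 0 := hi; positivity⟩)

lemma empiricalNorm_nonneg {m : ℕ} (v : Fin m → ℝ) : 0 ≤ empiricalNorm v :=
  div_nonneg (lqNorm_two_nonneg v) (Real.sqrt_nonneg _)

lemma empiricalNorm_sq {m : ℕ} (v : Fin m → ℝ) :
    empiricalNorm v ^ 2 = (1 / (m : ℝ)) * ∑ i, v i ^ 2 := by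
  unfold empiricalNorm
  rw [div_pow, lqNorm_two_sq, Real.sq_sqrt (Nat.cast_nonneg m)]
  ring

/-- The quotients are bounded below by zero, so the infimum lies below each of them and need not be
attained. -/
lemma restrictedEigenvalue_mul_le {m d : ℕ} (A : Matrix (Fin m) (Fin d) ℝ) {s : ℕ} {c₀ : ℝ}
    (J : Finset (Fin d)) (hJ : J.card ≤ s) (δ : Fin d → ℝ)
    (hδ : ∑ j ∈ Jᶜ, |δ j| ≤ c₀ * ∑ j ∈ J, |δ j|) :
    restrictedEigenvalue A s c₀ * lqNorm 2 δ ≤ empiricalNorm (A.mulVec δ) := by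
  by_cases h0 : δ = 0
  · have : lqNorm 2 δ = 0 := by rw [lqNorm_two_eq_sqrt]; simp [h0]
    rw [this, mul_zero]
    exact empiricalNorm_nonneg _
  have hpos := lqNorm_two_pos h0
  have hle : restrictedEigenvalue A s c₀ ≤
      lqNorm 2 (A.mulVec δ) / (Real.sqrt m * lqNorm 2 δ) := by
    refine csInf_le ⟨0, ?_⟩ ⟨J, hJ, δ, h0, hδ, rfl⟩
    rintro r ⟨J, -, δ, -, -, rfl⟩
    exact div_nonneg (lqNorm_two_nonneg _)
      (mul_nonneg (Real.sqrt_nonneg _) (lqNorm_two_nonneg _))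
  calc _ ≤ lqNorm 2 (A.mulVec δ) / (Real.sqrt m * lqNorm 2 δ) * lqNorm 2 δ :=
        mul_le_mul_of_nonneg_right hle hpos.le
    _ = empiricalNorm (A.mulVec δ) := by
        unfold empiricalNorm
        rw [← div_div, div_mul_cancel₀ _ hpos.ne']

/-- With no rows every quotient is `0` by the convention `x / 0 = 0`, and the infimum of the empty
set is `0` as well. Hence the condition supplies a design point. -/
lemma pos_of_restrictedEigenvalueCondition {m d s : ℕ} {A : Matrix (Fin m) (Fin d) ℝ} {c₀ : ℝ}
    (h : RestrictedEigenvalueCondition A s c₀) : 0 < m := by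
  rcases Nat.eq_zero_or_pos m with rfl | hm
  · exfalso
    unfold RestrictedEigenvalueCondition restrictedEigenvalue at h
    have hsub : {r : ℝ | ∃ J : Finset (Fin d), J.card ≤ s ∧ ∃ δ : Fin d → ℝ, δ ≠ 0 ∧
        ∑ j ∈ Jᶜ, |δ j| ≤ c₀ * ∑ j ∈ J, |δ j| ∧
        r = lqNorm 2 (A.mulVec δ) / (Real.sqrt (0 : ℕ) * lqNorm 2 δ)} ⊆ {0} := by
      rintro r ⟨J, -, δ, -, -, rfl⟩
      simp
    rcases Set.subset_singleton_iff_eq.1 hsub with h' | h' <;> rw [h'] at h <;> simp at h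
  · exact hm

/-- Log-convexity of `q ↦ |v|_q^q`, in the form used to interpolate between `q = 1` and `q = 2`. -/
lemma lqNorm_le_of_one_of_two {d : ℕ} (v : Fin d → ℝ) {M B : ℝ} (hM : 0 < M) (hB : 0 ≤ B)
    (h1 : ∑ j, |v j| ≤ M * B) (h2 : ∑ j, v j ^ 2 ≤ M ^ 2 * B) {q : ℝ} (hq1 : 1 ≤ q)
    (hq2 : q ≤ 2) : lqNorm q v ≤ M * B ^ (1 / q) := by
  have hq : 0 < q := by linarith
  -- Weighted AM-GM for `y` and `y ^ 2`: the weights sum to one and `q = (2 - q) * 1 + (q - 1) * 2`.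
  have key : ∀ y : ℝ, 0 ≤ y → y ^ q ≤ (2 - q) * y + (q - 1) * y ^ 2 := by
    intro y hy
    have := Real.geom_mean_le_arith_mean2_weighted (w₁ := 2 - q) (w₂ := q - 1) (p₁ := y)
      (p₂ := y ^ 2) (by linarith) (by linarith) hy (by positivity) (by ring)
    refine le_trans (le_of_eq ?_) this
    rcases hy.eq_or_lt with rfl | hy
    · rw [Real.zero_rpow hq.ne']
      -- For `q = 2` the factor `0 ^ (2 - q)` equals `1`, and the product vanishes through the other
      -- factor.
      by_cases hq' : q = 2
      · subst hq'; norm_num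
      · rw [Real.zero_rpow (by intro h; apply hq'; linarith)]; simp
    · rw [← Real.rpow_natCast y 2, ← Real.rpow_mul hy.le, ← Real.rpow_add hy]
      congr 1
      push_cast
      ring
  have hsum : ∑ j, |v j| ^ q ≤ M ^ q * B := by
    have h3 : ∀ j, |v j| ^ q ≤
        M ^ q * ((2 - q) * (|v j| / M) + (q - 1) * (v j ^ 2 / M ^ 2)) := by
      intro j
      have := key (|v j| / M) (by positivity)
      rw [Real.div_rpow (abs_nonneg _) hM.le, div_le_iff₀ (by positivity), div_pow, sq_abs] at this
      linarith
    calc ∑ j, |v j| ^ q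
        ≤ ∑ j, M ^ q * ((2 - q) * (|v j| / M) + (q - 1) * (v j ^ 2 / M ^ 2)) :=
          Finset.sum_le_sum fun j _ => h3 j
      _ = M ^ q * ((2 - q) * ((∑ j, |v j|) / M) + (q - 1) * ((∑ j, v j ^ 2) / M ^ 2)) := by
          rw [← Finset.mul_sum, Finset.sum_add_distrib, ← Finset.mul_sum, ← Finset.mul_sum,
            Finset.sum_div, Finset.sum_div]
      _ ≤ M ^ q * ((2 - q) * B + (q - 1) * B) := by
          have e1 : (∑ j, |v j|) / M ≤ B := by rw [div_le_iff₀ hM]; linarith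
          have e2 : (∑ j, v j ^ 2) / M ^ 2 ≤ B := by rw [div_le_iff₀ (by positivity)]; linarith
          have := mul_le_mul_of_nonneg_left e1 (by linarith : 0 ≤ 2 - q)
          have := mul_le_mul_of_nonneg_left e2 (by linarith : 0 ≤ q - 1)
          gcongr
      _ = M ^ q * B := by ring
  unfold lqNorm
  calc (∑ j, |v j| ^ q) ^ (1 / q) ≤ (M ^ q * B) ^ (1 / q) :=
        Real.rpow_le_rpow (Finset.sum_nonneg fun j _ => by positivity) hsum (by positivity)
    _ = M * B ^ (1 / q) := by
        rw [Real.mul_rpow (by positivity) hB, ← Real.rpow_mul hM.le,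
          mul_one_div_cancel hq.ne', Real.rpow_one]

/-- The Lasso cone condition and prediction bound, when the empirical correlations between noise
and regressors are at most `t` and `λ = γ t` with `γ ≥ 4`. -/
lemma lasso_basic_inequality {m d : ℕ} (A : Matrix (Fin m) (Fin d) ℝ) (Y : Fin m → ℝ)
    (βs βh : Fin d → ℝ) {γ t : ℝ} (hγ : 4 ≤ γ) (ht : 0 < t)
    (hnoise : ∀ j, |(1 / (m : ℝ)) * ∑ i, (Y i - A.mulVec βs i) * A i j| ≤ t)
    (hmin : lassoCriterion Y A (γ * t) βh ≤ lassoCriterion Y A (γ * t) βs)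
    (S : Finset (Fin d)) (hS : ∀ j ∉ S, βs j = 0) :
    empiricalNorm (A.mulVec (βh - βs)) ^ 2 ≤
      (γ + 2) * t * ∑ j ∈ S, |βh j - βs j| - (γ - 2) * t * ∑ j ∈ Sᶜ, |βh j - βs j| := by
  set δ := βh - βs with hδ
  have hAh : ∀ i, A.mulVec βh i = A.mulVec βs i + A.mulVec δ i := by
    intro i
    rw [hδ, Matrix.mulVec_sub, Pi.sub_apply]; ring
  have hcross : (1 / (m : ℝ)) * ∑ i, (Y i - A.mulVec βs i) * A.mulVec δ i ≤
      t * ∑ j, |δ j| := by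
    have : (1 / (m : ℝ)) * ∑ i, (Y i - A.mulVec βs i) * A.mulVec δ i =
        ∑ j, ((1 / (m : ℝ)) * ∑ i, (Y i - A.mulVec βs i) * A i j) * δ j := by
      simp only [Matrix.mulVec, dotProduct, Finset.mul_sum, Finset.sum_mul]
      rw [Finset.sum_comm]
      refine Finset.sum_congr rfl fun j _ => Finset.sum_congr rfl fun i _ => by ring
    rw [this, Finset.mul_sum]
    refine Finset.sum_le_sum fun j _ => ?_
    calc _ ≤ |((1 / (m : ℝ)) * ∑ i, (Y i - A.mulVec βs i) * A i j) * δ j| := le_abs_self _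
      _ ≤ t * |δ j| := by
        rw [abs_mul]; exact mul_le_mul_of_nonneg_right (hnoise j) (abs_nonneg _)
  have hexp : ∑ i, (Y i - A.mulVec βh i) ^ 2 = ∑ i, (Y i - A.mulVec βs i) ^ 2
      - 2 * ∑ i, (Y i - A.mulVec βs i) * A.mulVec δ i + ∑ i, A.mulVec δ i ^ 2 := by
    rw [Finset.mul_sum, ← Finset.sum_sub_distrib, ← Finset.sum_add_distrib]
    refine Finset.sum_congr rfl fun i _ => ?_
    rw [hAh]; ring
  unfold lassoCriterion at hmin
  rw [hexp] at hmin
  rw [empiricalNorm_sq]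
  -- On `S` this is the reverse triangle inequality; off `S` the true coefficient vanishes and `δ`
  -- equals `βh`.
  have hl1 : ∑ j, |βs j| - ∑ j, |βh j| ≤ ∑ j ∈ S, |δ j| - ∑ j ∈ Sᶜ, |δ j| := by
    rw [← Finset.sum_sub_distrib, ← Finset.sum_add_sum_compl S, sub_eq_add_neg,
      ← Finset.sum_neg_distrib]
    refine add_le_add (Finset.sum_le_sum fun j _ => ?_) (Finset.sum_le_sum fun j hj => ?_)
    · have := abs_sub_abs_le_abs_sub (βs j) (βh j)
      rwa [abs_sub_comm] at this
    · have h0 := hS j (Finset.mem_compl.1 hj)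
      simp [hδ, h0]
  have htot : ∑ j, |δ j| = ∑ j ∈ S, |δ j| + ∑ j ∈ Sᶜ, |δ j| :=
    (Finset.sum_add_sum_compl S _).symm
  rw [htot] at hcross
  have hγt : 0 ≤ γ * t := by nlinarith
  have h5 := mul_le_mul_of_nonneg_left hl1 hγt
  have hgoal : ∀ j, |βh j - βs j| = |δ j| := fun j => rfl
  simp only [hgoal]
  -- The cross term has coefficient two in the expanded square, which turns `γ` into `γ + 2` on `S`
  -- and `γ - 2` off `S`.
  nlinarith [hmin, h5, hcross]

/-- The basic inequality puts `δ` in the cone. There `κ N ≤ E`, while Cauchy-Schwarz on the support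
gives `a ≤ √s N`, so `E ^ 2 ≤ (γ + 2) t √s N` can be divided by `E`. This bounds `E`, then `N`, then
the `ℓ¹` norm, and interpolation covers the remaining `q`. -/
theorem lasso_oracle_inequality {m d s : ℕ} (A : Matrix (Fin m) (Fin d) ℝ) (Y : Fin m → ℝ)
    (βs βh : Fin d → ℝ) {γ t : ℝ} (hγ : 4 ≤ γ) (ht : 0 < t) (hs : 1 ≤ s)
    (hRE : RestrictedEigenvalueCondition A s 3)
    (hsparse : (Finset.univ.filter fun j => βs j ≠ 0).card ≤ s)
    (hnoise : ∀ j, |(1 / (m : ℝ)) * ∑ i, (Y i - A.mulVec βs i) * A i j| ≤ t)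
    (hmin : lassoCriterion Y A (γ * t) βh ≤ lassoCriterion Y A (γ * t) βs) :
    empiricalNorm (A.mulVec (βh - βs)) ≤
        4 * (γ + 1) * t * Real.sqrt s / restrictedEigenvalue A s 3 ∧
      ∀ q : ℝ, 1 ≤ q → q ≤ 2 → lqNorm q (βh - βs) ≤
        (4 : ℝ) ^ (2 / q) * (γ + 1) * t * (s : ℝ) ^ (1 / q) / restrictedEigenvalue A s 3 ^ 2 := by
  set S := Finset.univ.filter fun j => βs j ≠ 0
  have hbasic := lasso_basic_inequality A Y βs βh hγ ht hnoise hmin S (by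
    intro j hj; by_contra h; exact hj (by simp [S, h]))
  set κ := restrictedEigenvalue A s 3
  have hκ : 0 < κ := hRE
  set δ := βh - βs
  set a := ∑ j ∈ S, |δ j|
  set b := ∑ j ∈ Sᶜ, |δ j|
  set E := empiricalNorm (A.mulVec δ)
  set N := lqNorm 2 δ
  have ha : 0 ≤ a := Finset.sum_nonneg fun _ _ => abs_nonneg _
  have hb : 0 ≤ b := Finset.sum_nonneg fun _ _ => abs_nonneg _
  have hE : 0 ≤ E := empiricalNorm_nonneg _
  have hN : 0 ≤ N := lqNorm_two_nonneg _
  have hbasic : E ^ 2 ≤ (γ + 2) * t * a - (γ - 2) * t * b := hbasic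
  -- For `γ ≥ 4` the ratio `(γ + 2) / (γ - 2)` is at most `3`.
  have hcone : b ≤ 3 * a := by
    have h1 : 0 ≤ (γ + 2) * a - (γ - 2) * b := by
      by_contra hneg
      push Not at hneg
      nlinarith [sq_nonneg E]
    nlinarith
  have hκN : κ * N ≤ E := restrictedEigenvalue_mul_le A S hsparse δ hcone
  set r := Real.sqrt s
  have hr0 : 0 ≤ r := Real.sqrt_nonneg _
  have hr2 : r ^ 2 = s := Real.sq_sqrt (Nat.cast_nonneg s)
  have haN : a ≤ r * N := by
    have hcs : a ^ 2 ≤ S.card * ∑ j ∈ S, |δ j| ^ 2 := sq_sum_le_card_mul_sum_sq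
    have h1 : ∑ j ∈ S, |δ j| ^ 2 ≤ N ^ 2 := by
      rw [lqNorm_two_sq]
      simp only [sq_abs]
      exact Finset.sum_le_sum_of_subset_of_nonneg (Finset.subset_univ S)
        fun _ _ _ => sq_nonneg _
    have h2 : a ^ 2 ≤ (r * N) ^ 2 := by
      rw [mul_pow, hr2]
      have hc : (S.card : ℝ) ≤ s := by exact_mod_cast hsparse
      calc a ^ 2 ≤ S.card * ∑ j ∈ S, |δ j| ^ 2 := hcs
        _ ≤ s * N ^ 2 := mul_le_mul hc h1 (by positivity) (by positivity)
    exact le_of_sq_le_sq h2 (by positivity)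
  have hEle : E * κ ≤ (γ + 2) * t * r := by
    have h1 : E ^ 2 ≤ (γ + 2) * t * (r * N) := by
      have : 0 ≤ (γ - 2) * t * b := by
        have : 0 ≤ γ - 2 := by linarith
        positivity
      have : (γ + 2) * t * a ≤ (γ + 2) * t * (r * N) :=
        mul_le_mul_of_nonneg_left haN (by nlinarith)
      linarith
    rcases hE.eq_or_lt with h0 | hEpos
    · rw [← h0, zero_mul]
      have : 0 ≤ γ + 2 := by linarith
      positivity
    · have h2 : E * (E * κ) ≤ E * ((γ + 2) * t * r) := by
        calc E * (E * κ) = E ^ 2 * κ := by ring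
          _ ≤ (γ + 2) * t * (r * N) * κ := mul_le_mul_of_nonneg_right h1 hκ.le
          _ = (γ + 2) * t * r * (κ * N) := by ring
          _ ≤ (γ + 2) * t * r * E := mul_le_mul_of_nonneg_left hκN
              (by have : 0 ≤ γ + 2 := by linarith
                  positivity)
          _ = _ := by ring
      exact le_of_mul_le_mul_left h2 hEpos
  have htr : 0 ≤ t * r := by positivity
  constructor
  · rw [le_div_iff₀ hκ]
    nlinarith
  · intro q hq1 hq2
    have hκ2 : 0 < κ ^ 2 := by positivity
    have hNle : N * κ ^ 2 ≤ (γ + 2) * t * r := by nlinarith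
    set M := (γ + 1) * t / κ ^ 2 with hM
    have hγ1 : 0 < γ + 1 := by linarith
    have hMpos : 0 < M := by positivity
    have hN4 : N ≤ 4 * M * r := by
      have : N * κ ^ 2 ≤ 4 * ((γ + 1) * t) * r := by nlinarith
      calc N = N * κ ^ 2 / κ ^ 2 := by field_simp
        _ ≤ 4 * ((γ + 1) * t) * r / κ ^ 2 := by gcongr
        _ = 4 * M * r := by rw [hM]; ring
    -- In the cone `|δ|₁ ≤ 4 a ≤ 4 r N ≤ 16 M s`. The `ℓ²` bound has the same factor `16 s`, and `16
    -- ^ (1 / q) = 4 ^ (2 / q)`.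
    have h1 : ∑ j, |δ j| ≤ M * (16 * s) := by
      rw [← Finset.sum_add_sum_compl S]
      change a + b ≤ _
      rw [← hr2]
      nlinarith [mul_le_mul_of_nonneg_left hN4 hr0]
    have h2 : ∑ j, δ j ^ 2 ≤ M ^ 2 * (16 * s) := by
      rw [← lqNorm_two_sq, ← hr2]
      calc N ^ 2 ≤ (4 * M * r) ^ 2 := by gcongr
        _ = _ := by ring
    refine (lqNorm_le_of_one_of_two δ hMpos (by positivity) h1 h2 hq1 hq2).trans
      (le_of_eq ?_)
    rw [Real.mul_rpow (by norm_num) (by positivity), hM,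
      show (16 : ℝ) = 4 ^ (2 : ℝ) by norm_num, ← Real.rpow_mul (by norm_num), mul_one_div]
    ring

/-! ### Bernstein inequalities for averages and `U`-statistics -/

/-- The exponential series from degree two on is dominated termwise by a geometric series of ratio
`c / 3`, because `(n + 2)! ≥ 2 * 3 ^ n`. -/
lemma exp_le_of_abs_le {x c : ℝ} (hx : |x| ≤ c) (hc : c < 3) :
    Real.exp x ≤ 1 + x + x ^ 2 / (2 * (1 - c / 3)) := by
  have hc0 : 0 ≤ c := (abs_nonneg x).trans hx
  have h1 : HasSum (fun n : ℕ => x ^ n / (n.factorial : ℝ)) (Real.exp x) := by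
    rw [Real.exp_eq_exp_ℝ]; exact NormedSpace.expSeries_div_hasSum_exp x
  have h2 := (hasSum_nat_add_iff' 2).2 h1
  have h3 : HasSum (fun n : ℕ => x ^ 2 / 2 * (c / 3) ^ n) (x ^ 2 / 2 * (1 - c / 3)⁻¹) :=
    (hasSum_geometric_of_lt_one (by positivity) (by linarith)).mul_left _
  have h4 := hasSum_le (fun n => ?_) h2 h3
  · simp only [Finset.sum_range_succ, Finset.sum_range_zero, pow_zero, pow_one] at h4
    norm_num at h4
    have : x ^ 2 / 2 * (1 - c / 3)⁻¹ = x ^ 2 / (2 * (1 - c / 3)) := by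
      rw [← div_div, div_eq_mul_inv (x ^ 2 / 2)]
    rw [← this]
    linarith
  · have hfac : (2 * 3 ^ n : ℝ) ≤ ((n + 2).factorial : ℝ) := by
      have := Nat.factorial_mul_pow_le_factorial (m := 2) (n := n)
      rw [add_comm n 2]
      exact_mod_cast this
    have hxn : x ^ n ≤ c ^ n := by
      calc x ^ n ≤ |x ^ n| := le_abs_self _
        _ = |x| ^ n := abs_pow _ _
        _ ≤ c ^ n := by gcongr
    calc x ^ (n + 2) / ((n + 2).factorial : ℝ) = x ^ 2 * x ^ n / ((n + 2).factorial : ℝ) := by ring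
      _ ≤ x ^ 2 * c ^ n / ((n + 2).factorial : ℝ) := by gcongr
      _ ≤ x ^ 2 * c ^ n / (2 * 3 ^ n) := by gcongr
      _ = x ^ 2 / 2 * (c / 3) ^ n := by rw [div_pow]; field_simp

section
variable {Ω : Type*} [MeasurableSpace Ω] {μ : Measure Ω} [IsProbabilityMeasure μ]

lemma integrable_of_abs_le {ξ : Ω → ℝ} (hm : Measurable ξ) {b : ℝ} (hb : ∀ ω, |ξ ω| ≤ b) :
    Integrable ξ μ :=
  Integrable.of_bound hm.aestronglyMeasurable b (Filter.Eventually.of_forall hb)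

lemma integrable_exp_of_abs_le {ξ : Ω → ℝ} (hm : Measurable ξ) {b : ℝ} (hb : ∀ ω, |ξ ω| ≤ b)
    (l : ℝ) : Integrable (fun ω => Real.exp (l * ξ ω)) μ := by
  refine integrable_of_abs_le (b := Real.exp (|l| * b)) (hm.const_mul l).exp fun ω => ?_
  rw [abs_of_pos (Real.exp_pos _)]
  refine Real.exp_le_exp.2 ((le_abs_self _).trans ?_)
  rw [abs_mul]
  exact mul_le_mul_of_nonneg_left (hb ω) (abs_nonneg _)

/-- Bernstein's bound for the moment generating function, in terms of the uncentred second moment. -/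
lemma mgf_le_of_abs_le {ξ : Ω → ℝ} (hm : Measurable ξ) {b v l : ℝ} (hb : ∀ ω, |ξ ω| ≤ b)
    (hv : ∫ ω, ξ ω ^ 2 ∂μ ≤ v) (hl : 0 ≤ l) (hlb : l * b < 3) :
    mgf ξ μ l ≤ Real.exp (l * (∫ ω, ξ ω ∂μ) + l ^ 2 * v / (2 * (1 - l * b / 3))) := by
  have hden : 0 < 2 * (1 - l * b / 3) := by linarith
  have hi := integrable_of_abs_le (μ := μ) hm hb
  have hi2 : Integrable (fun ω => ξ ω ^ 2) μ := by
    refine integrable_of_abs_le (b := b ^ 2) (hm.pow_const 2) fun ω => ?_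
    rw [abs_pow]
    exact pow_le_pow_left₀ (abs_nonneg _) (hb ω) 2
  have h1 : mgf ξ μ l ≤ ∫ ω, (1 + l * ξ ω + (l ^ 2 / (2 * (1 - l * b / 3))) * ξ ω ^ 2) ∂μ := by
    refine integral_mono (integrable_exp_of_abs_le hm hb l)
      (((integrable_const _).add (hi.const_mul l)).add (hi2.const_mul _)) fun ω => ?_
    have := exp_le_of_abs_le (x := l * ξ ω) (c := l * b)
      (by rw [abs_mul, abs_of_nonneg hl]; exact mul_le_mul_of_nonneg_left (hb ω) hl) hlb
    calc Real.exp (l * ξ ω) ≤ _ := this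
      _ = _ := by ring
  have h2 : ∫ ω, (1 + l * ξ ω + (l ^ 2 / (2 * (1 - l * b / 3))) * ξ ω ^ 2) ∂μ =
      ∫ _ω, (1 : ℝ) ∂μ + l * ∫ ω, ξ ω ∂μ +
        (l ^ 2 / (2 * (1 - l * b / 3))) * ∫ ω, ξ ω ^ 2 ∂μ := by
    rw [← integral_const_mul, ← integral_const_mul,
      ← integral_add (integrable_const _) (hi.const_mul l),
      ← integral_add (by exact (integrable_const _).add (hi.const_mul l)) (hi2.const_mul _)]
  rw [h2] at h1
  simp only [integral_const, probReal_univ, smul_eq_mul, one_mul] at h1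
  refine h1.trans (le_trans ?_ (Real.add_one_le_exp _))
  have : l ^ 2 / (2 * (1 - l * b / 3)) * ∫ ω, ξ ω ^ 2 ∂μ ≤ l ^ 2 * v / (2 * (1 - l * b / 3)) := by
    rw [div_mul_eq_mul_div]
    gcongr
  linarith

/-- Independence factorises the exponential moment into moment generating functions at `l / m`. The
resulting form is shared with the `U`-statistic, so a single Chernoff argument serves both. -/
lemma average_mgf_le {m : ℕ} (hm0 : 0 < m) {ξ : Fin m → Ω → ℝ} (hind : iIndepFun ξ μ)
    (hm : ∀ k, Measurable (ξ k)) {b v e l : ℝ} (hb : ∀ k ω, |ξ k ω| ≤ b)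
    (hv : ∀ k, ∫ ω, ξ k ω ^ 2 ∂μ ≤ v) (he : ∀ k, ∫ ω, ξ k ω ∂μ = e) (hl : 0 ≤ l)
    (hlb : l * b < 3 * m) :
    ∫ ω, Real.exp (l * ((1 / (m : ℝ)) * ∑ k, ξ k ω - e)) ∂μ ≤
      Real.exp (l ^ 2 * v / (2 * m * (1 - l * b / (3 * m)))) := by
  have hmR : (0 : ℝ) < m := by exact_mod_cast hm0
  have h1 : ∀ ω, Real.exp (l * ((1 / (m : ℝ)) * ∑ k, ξ k ω - e)) =
      Real.exp (-(l * e)) * Real.exp (l / m * (∑ k, ξ k) ω) := by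
    intro ω
    rw [← Real.exp_add, Finset.sum_apply]
    congr 1
    ring
  simp_rw [h1]
  rw [integral_const_mul]
  have h2 := hind.mgf_sum hm (t := l / m) Finset.univ
  have h3 : mgf (∑ k, ξ k) μ (l / m) ≤
      Real.exp (m * (l / m * e + (l / m) ^ 2 * v / (2 * (1 - l / m * b / 3)))) := by
    rw [h2]
    calc ∏ k, mgf (ξ k) μ (l / m)
        ≤ ∏ _k : Fin m, Real.exp (l / m * e + (l / m) ^ 2 * v / (2 * (1 - l / m * b / 3))) := by
          refine Finset.prod_le_prod (fun k _ => mgf_nonneg) fun k _ => ?_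
          have := mgf_le_of_abs_le (μ := μ) (hm k) (hb k) (hv k) (l := l / m) (by positivity)
            (by rw [div_mul_eq_mul_div, div_lt_iff₀ hmR]; exact hlb)
          rwa [he k] at this
      _ = _ := by
          rw [Finset.prod_const, ← Real.exp_nat_mul]; simp
  calc _ ≤ Real.exp (-(l * e)) *
        Real.exp (m * (l / m * e + (l / m) ^ 2 * v / (2 * (1 - l / m * b / 3)))) :=
        mul_le_mul_of_nonneg_left h3 (Real.exp_pos _).le
    _ = _ := by
        rw [← Real.exp_add]
        have h6 : (1 - l * b / (3 * m)) ≠ 0 := by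
          have : l * b / (3 * m) < 1 := by rw [div_lt_one (by positivity)]; exact hlb
          linarith
        have h5 : l / m * b / 3 = l * b / (3 * m) := by field_simp
        rw [h5]
        congr 1
        set c := 1 - l * b / (3 * m)
        field_simp
        ring

lemma measureReal_ge_le_of_mgf_le {m : ℕ} (hm0 : 0 < m) {Y : Ω → ℝ} {b v x : ℝ} (hb : 0 ≤ b)
    (hv : 0 < v) (hx : 0 < x)
    (hint : ∀ l, Integrable (fun ω => Real.exp (l * Y ω)) μ)
    (hY : ∀ l, 0 ≤ l → l * b < 3 * m →
      ∫ ω, Real.exp (l * Y ω) ∂μ ≤ Real.exp (l ^ 2 * v / (2 * m * (1 - l * b / (3 * m))))) :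
    μ.real {ω | x ≤ Y ω} ≤ Real.exp (-(m * x ^ 2 / (2 * v + 2 / 3 * b * x))) := by
  have hmR : (0 : ℝ) < m := by exact_mod_cast hm0
  set d := v + b * x / 3 with hd
  have hd0 : 0 < d := by positivity
  -- With this choice `1 - l * b / (3 * m) = v / d`, and the Chernoff exponent `-l x + l ^ 2 d / (2
  -- m)` becomes `-m x ^ 2 / (2 d)`.
  set l := m * x / d with hldef
  have hl : 0 ≤ l := by positivity
  have hratio : 1 - l * b / (3 * m) = v / d := by
    rw [hldef]; field_simp; rw [hd]; ring
  have hlb : l * b < 3 * m := by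
    have : 0 < 1 - l * b / (3 * m) := by rw [hratio]; positivity
    have : l * b / (3 * m) < 1 := by linarith
    rwa [div_lt_one (by positivity)] at this
  have h1 := measure_ge_le_exp_mul_mgf (μ := μ) (X := Y) x hl (hint l)
  refine h1.trans ((mul_le_mul_of_nonneg_left (hY l hl hlb) (Real.exp_pos _).le).trans ?_)
  rw [← Real.exp_add, hratio]
  refine Real.exp_le_exp.2 (le_of_eq ?_)
  have : 2 * v + 2 / 3 * b * x = 2 * d := by rw [hd]; ring
  rw [this, hldef]
  field_simp
  ring

lemma average_abs_le {m : ℕ} (hm0 : 0 < m) {y : Fin m → ℝ} {b : ℝ} (hb : ∀ k, |y k| ≤ b) :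
    |(1 / (m : ℝ)) * ∑ k, y k| ≤ b := by
  have hmR : (0 : ℝ) < m := by exact_mod_cast hm0
  rw [abs_mul, abs_of_pos (by positivity : 0 < 1 / (m : ℝ)), one_div, inv_mul_le_iff₀ hmR]
  calc |∑ k, y k| ≤ ∑ k, |y k| := Finset.abs_sum_le_sum_abs _ _
    _ ≤ ∑ _k : Fin m, b := Finset.sum_le_sum fun k _ => hb k
    _ = m * b := by simp

lemma measureReal_abs_ge_le {Y : Ω → ℝ} {x B : ℝ} (h1 : μ.real {ω | x ≤ Y ω} ≤ B)
    (h2 : μ.real {ω | x ≤ - Y ω} ≤ B) : μ.real {ω | x ≤ |Y ω|} ≤ 2 * B := by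
  have : {ω | x ≤ |Y ω|} ⊆ {ω | x ≤ Y ω} ∪ {ω | x ≤ - Y ω} := by
    intro ω hω
    exact le_abs.1 (show x ≤ |Y ω| from hω)
  calc _ ≤ μ.real ({ω | x ≤ Y ω} ∪ {ω | x ≤ - Y ω}) := measureReal_mono this
    _ ≤ _ := measureReal_union_le _ _
    _ ≤ 2 * B := by linarith

/-- Bernstein's inequality. -/
theorem bernstein_average {m : ℕ} (hm0 : 0 < m) {ξ : Fin m → Ω → ℝ} (hind : iIndepFun ξ μ)
    (hm : ∀ k, Measurable (ξ k)) {b v e x : ℝ} (hb : ∀ k ω, |ξ k ω| ≤ b)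
    (hv : ∀ k, ∫ ω, ξ k ω ^ 2 ∂μ ≤ v) (he : ∀ k, ∫ ω, ξ k ω ∂μ = e) (hb0 : 0 ≤ b) (hv0 : 0 < v)
    (hx : 0 < x) :
    μ.real {ω | x ≤ |(1 / (m : ℝ)) * ∑ k, ξ k ω - e|} ≤
      2 * Real.exp (-(m * x ^ 2 / (2 * v + 2 / 3 * b * x))) := by
  have hint : ∀ l, Integrable
      (fun ω => Real.exp (l * ((1 / (m : ℝ)) * ∑ k, ξ k ω - e))) μ := by
    refine integrable_exp_of_abs_le (b := b + |e|)
      (((Finset.measurable_sum _ fun k _ => hm k).const_mul _).sub_const _) fun ω => ?_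
    refine (abs_sub _ _).trans (add_le_add ?_ le_rfl)
    exact average_abs_le hm0 fun k => hb k ω
  refine measureReal_abs_ge_le ?_ ?_
  · exact measureReal_ge_le_of_mgf_le hm0 hb0 hv0 hx hint fun l hl hlb =>
      average_mgf_le hm0 hind hm hb hv he hl hlb
  · refine measureReal_ge_le_of_mgf_le hm0 hb0 hv0 hx
      (fun l => by simpa only [neg_mul_comm] using hint (-l)) fun l hl hlb => ?_
    have := average_mgf_le (μ := μ) (l := l) (b := b) (v := v) (e := -e) hm0
      (ξ := fun k ω => - ξ k ω)
      (hind.comp (fun _ y => -y) fun _ => measurable_neg) (fun k => (hm k).neg)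
      (by simpa using hb) (by simpa using hv)
      (fun k => by rw [integral_neg, he k]) hl hlb
    refine le_trans (le_of_eq ?_) this
    refine integral_congr_ae (Filter.Eventually.of_forall fun ω => ?_)
    simp only [Finset.sum_neg_distrib]
    congr 1
    ring

/-- Induction over finite sets of pairs: a new pair reads coordinates disjoint from those already
used, hence is independent of the whole earlier family. -/
lemma iIndepFun_pair {ι κ E : Type*} [MeasurableSpace E] [DecidableEq ι]
    {W : ι → Ω → E} (hW : iIndepFun W μ) (hm : ∀ i, Measurable (W i)) (a b : κ → ι)
    (hab : ∀ k l, k ≠ l → a k ≠ a l ∧ a k ≠ b l ∧ b k ≠ a l ∧ b k ≠ b l) :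
    iIndepFun (fun k ω => (W (a k) ω, W (b k) ω)) μ := by
  classical
  rw [iIndepFun_iff_measure_inter_preimage_eq_mul]
  intro S
  induction S using Finset.induction_on with
  | empty => intro sets _; simp
  | insert k S hk ih =>
    intro sets hsets
    rw [Finset.set_biInter_insert, Finset.prod_insert hk,
      ← ih fun i hi => hsets i (Finset.mem_insert_of_mem hi)]
    have hdisj : Disjoint ({a k, b k} : Finset ι) (S.image a ∪ S.image b) := by
      rw [Finset.disjoint_left]
      intro i hi hi'
      simp only [Finset.mem_insert, Finset.mem_singleton] at hi
      simp only [Finset.mem_union, Finset.mem_image] at hi'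
      have hne : ∀ l ∈ S, k ≠ l := fun l hl h => hk (h ▸ hl)
      rcases hi with rfl | rfl <;> rcases hi' with ⟨l, hl, h⟩ | ⟨l, hl, h⟩
      · exact (hab k l (hne l hl)).1 h.symm
      · exact (hab k l (hne l hl)).2.1 h.symm
      · exact (hab k l (hne l hl)).2.2.1 h.symm
      · exact (hab k l (hne l hl)).2.2.2 h.symm
    have hind := hW.indepFun_finset _ _ hdisj hm
    have hφ : Measurable fun y : ({a k, b k} : Finset ι) → E =>
        (y ⟨a k, by simp⟩, y ⟨b k, by simp⟩) := by fun_prop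
    have hψ : Measurable fun (y : (S.image a ∪ S.image b : Finset ι) → E) (i : S) =>
        (y ⟨a i.1, Finset.mem_union_left _ (Finset.mem_image_of_mem a i.2)⟩,
          y ⟨b i.1, Finset.mem_union_right _ (Finset.mem_image_of_mem b i.2)⟩) := by fun_prop
    have hind' := hind.comp hφ hψ
    have h3 := hind'.measure_inter_preimage_eq_mul (sets k)
      {y : S → E × E | ∀ i, y i ∈ sets i.1} (hsets k (Finset.mem_insert_self _ _)) (by
        rw [Set.ofPred_forall]
        exact MeasurableSet.iInter fun i =>
          measurable_pi_apply i (hsets i.1 (Finset.mem_insert_of_mem i.2)))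
    have h4 : (⋂ i ∈ S, (fun ω => (W (a i) ω, W (b i) ω)) ⁻¹' sets i) =
        {ω | ∀ i : S, (W (a i) ω, W (b i) ω) ∈ sets i} := by
      ext ω; simp
    rw [h4]
    exact h3

/-- The symmetric group is doubly transitive, so the sum over `σ` is the same for every ordered pair
of distinct indices. Summing it over all `n (n - 1)` such pairs and exchanging the sums gives the
identity. -/
lemma sum_perm_apply_eq {n : ℕ} (G : Fin n → Fin n → ℝ) {a b : Fin n} (hab : a ≠ b) :
    ((n : ℝ) * (n - 1)) * ∑ σ : Equiv.Perm (Fin n), G (σ a) (σ b) =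
      n.factorial * ∑ q ∈ Finset.univ.offDiag, G q.1 q.2 := by
  have h1 : ∀ q ∈ (Finset.univ : Finset (Fin n)).offDiag,
      ∑ σ : Equiv.Perm (Fin n), G (σ q.1) (σ q.2) =
        ∑ σ : Equiv.Perm (Fin n), G (σ a) (σ b) := by
    intro q hq
    have hq' : q.1 ≠ q.2 := (Finset.mem_offDiag.1 hq).2.2
    obtain ⟨π, h1, h2⟩ := MulAction.is_two_pretransitive_iff.1
      (Equiv.Perm.isMultiplyPretransitive (Fin n) 2) hab hq'
    rw [← Equiv.sum_comp (Equiv.mulRight π) fun σ => G (σ a) (σ b)]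
    refine Finset.sum_congr rfl fun σ _ => ?_
    rw [← h1, ← h2]
    rfl
  have h2 := Finset.sum_congr rfl h1
  rw [Finset.sum_const, Finset.sum_comm] at h2
  have h3 : ∀ σ : Equiv.Perm (Fin n), ∑ q ∈ (Finset.univ : Finset (Fin n)).offDiag,
      G (σ q.1) (σ q.2) = ∑ q ∈ (Finset.univ : Finset (Fin n)).offDiag, G q.1 q.2 := by
    intro σ
    refine Finset.sum_equiv (σ.prodCongr σ) (fun q => ?_) (fun q _ => rfl)
    simp [Finset.mem_offDiag]
  simp_rw [h3] at h2
  rw [Finset.sum_const, Finset.card_univ, Fintype.card_perm, Fintype.card_fin,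
    Finset.offDiag_card, Finset.card_univ, Fintype.card_fin, nsmul_eq_mul, nsmul_eq_mul,
    Nat.cast_sub (Nat.le_mul_self n)] at h2
  rw [h2]
  push_cast
  ring

/-- Representation of a `U`-statistic as an average, over permutations, of block averages. -/
lemma uStatistic_eq_average {n m : ℕ} (hm0 : 0 < m) (hmn : 2 * m ≤ n) (G : Fin n → Fin n → ℝ) :
    (1 / ((n : ℝ) * (n - 1))) * ∑ q ∈ Finset.univ.offDiag, G q.1 q.2 =
      ∑ σ : Equiv.Perm (Fin n), (1 / (n.factorial : ℝ)) *
        ((1 / (m : ℝ)) * ∑ k : Fin m,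
          G (σ ⟨2 * k.1, by omega⟩) (σ ⟨2 * k.1 + 1, by omega⟩)) := by
  have hmR : (0 : ℝ) < m := by exact_mod_cast hm0
  have hn2 : (2 : ℝ) ≤ n := by exact_mod_cast (by omega : 2 ≤ n)
  have hn1 : (0 : ℝ) < n - 1 := by linarith
  have hf : (0 : ℝ) < n.factorial := by exact_mod_cast n.factorial_pos
  rw [← Finset.mul_sum, ← Finset.mul_sum, Finset.sum_comm]
  have : ∀ k : Fin m, ∑ σ : Equiv.Perm (Fin n),
      G (σ ⟨2 * k.1, by omega⟩) (σ ⟨2 * k.1 + 1, by omega⟩) =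
      n.factorial * (∑ q ∈ Finset.univ.offDiag, G q.1 q.2) / ((n : ℝ) * (n - 1)) := by
    intro k
    rw [eq_div_iff (by positivity), ← sum_perm_apply_eq G (a := ⟨2 * k.1, by omega⟩)
      (b := ⟨2 * k.1 + 1, by omega⟩) (by simp [Fin.ext_iff])]
    ring
  simp_rw [this]
  rw [Finset.sum_const, Finset.card_univ, Fintype.card_fin, nsmul_eq_mul]
  field_simp

/-- By Jensen's inequality the exponential of an average over permutations is at most the average of
the exponentials. Each of these involves a mean of `m` independent terms, to which `average_mgf_le`
applies. -/
lemma uStatistic_mgf_le {E : Type*} [MeasurableSpace E] {n m : ℕ} (hm0 : 0 < m) (hmn : 2 * m ≤ n)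
    {W : Fin n → Ω → E} (hW : iIndepFun W μ) (hWm : ∀ i, Measurable (W i)) {ν : Measure E}
    (hlaw : ∀ i, μ.map (W i) = ν) {F : E × E → ℝ} (hF : Measurable F) {b v l : ℝ}
    (hb : ∀ w, |F w| ≤ b) (hv : ∫ w, F w ^ 2 ∂(ν.prod ν) ≤ v) (hl : 0 ≤ l)
    (hlb : l * b < 3 * m) :
    ∫ ω, Real.exp (l * ((1 / ((n : ℝ) * (n - 1))) *
        ∑ q ∈ Finset.univ.offDiag, F (W q.1 ω, W q.2 ω) - ∫ w, F w ∂(ν.prod ν))) ∂μ ≤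
      Real.exp (l ^ 2 * v / (2 * m * (1 - l * b / (3 * m)))) := by
  set e := ∫ w, F w ∂(ν.prod ν)
  have hf : (0 : ℝ) < n.factorial := by exact_mod_cast n.factorial_pos
  set blk : Equiv.Perm (Fin n) → Ω → ℝ := fun σ ω => (1 / (m : ℝ)) * ∑ k : Fin m,
    F (W (σ ⟨2 * k.1, by omega⟩) ω, W (σ ⟨2 * k.1 + 1, by omega⟩) ω) with hblk
  have hblkm : ∀ σ, Measurable (blk σ) := fun σ =>
    (Finset.measurable_sum _ fun k _ => hF.comp ((hWm _).prodMk (hWm _))).const_mul _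
  have hint : ∀ σ, Integrable (fun ω => Real.exp (l * (blk σ ω - e))) μ := by
    intro σ
    refine integrable_exp_of_abs_le (b := b + |e|) ((hblkm σ).sub_const _) (fun ω => ?_) l
    exact (abs_sub _ _).trans (add_le_add (average_abs_le hm0 fun k => hb _) le_rfl)
  have hw : ∑ _σ : Equiv.Perm (Fin n), 1 / (n.factorial : ℝ) = 1 := by
    rw [Finset.sum_const, Finset.card_univ, Fintype.card_perm, Fintype.card_fin, nsmul_eq_mul,
      mul_one_div_cancel hf.ne']
  have hconv : ∀ ω, Real.exp (l * ((1 / ((n : ℝ) * (n - 1))) *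
        ∑ q ∈ Finset.univ.offDiag, F (W q.1 ω, W q.2 ω) - e)) ≤
      ∑ σ, (1 / (n.factorial : ℝ)) * Real.exp (l * (blk σ ω - e)) := by
    intro ω
    rw [uStatistic_eq_average hm0 hmn fun i j => F (W i ω, W j ω)]
    have := convexOn_exp.map_sum_le (t := Finset.univ)
      (w := fun _ : Equiv.Perm (Fin n) => 1 / (n.factorial : ℝ))
      (p := fun σ => l * (blk σ ω - e)) (fun _ _ => by positivity) hw (fun _ _ => Set.mem_univ _)
    simp only [smul_eq_mul] at this
    refine le_trans (le_of_eq ?_) this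
    congr 1
    have h3 : ∑ σ, 1 / (n.factorial : ℝ) * (l * (blk σ ω - e)) =
        l * (∑ σ, 1 / (n.factorial : ℝ) * blk σ ω) -
          l * e * ∑ _σ : Equiv.Perm (Fin n), 1 / (n.factorial : ℝ) := by
      rw [Finset.mul_sum, Finset.mul_sum, ← Finset.sum_sub_distrib]
      exact Finset.sum_congr rfl fun σ _ => by ring
    rw [h3, hw]
    ring
  have hUm : Measurable fun ω => (1 / ((n : ℝ) * (n - 1))) *
        ∑ q ∈ (Finset.univ : Finset (Fin n)).offDiag, F (W q.1 ω, W q.2 ω) - e :=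
    ((Finset.measurable_sum _ fun q _ => hF.comp ((hWm _).prodMk (hWm _))).const_mul _).sub_const _
  refine (integral_mono_of_nonneg (Filter.Eventually.of_forall fun ω => (Real.exp_pos _).le)
    (integrable_finsetSum _ fun σ _ => (hint σ).const_mul _)
    (Filter.Eventually.of_forall hconv)).trans ?_
  rw [integral_finsetSum _ fun σ _ => (hint σ).const_mul _]
  simp_rw [integral_const_mul]
  calc _ ≤ ∑ _σ : Equiv.Perm (Fin n), 1 / (n.factorial : ℝ) *
        Real.exp (l ^ 2 * v / (2 * m * (1 - l * b / (3 * m)))) := by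
        refine Finset.sum_le_sum fun σ _ => mul_le_mul_of_nonneg_left ?_ (by positivity)
        -- The positions `2k` and `2k + 1` are distinct for different blocks, and `σ` is injective.
        have hpair := iIndepFun_pair hW hWm (κ := Fin m) (fun k => σ ⟨2 * k.1, by omega⟩)
          (fun k => σ ⟨2 * k.1 + 1, by omega⟩) (fun k l' hkl => by
            have hkl' : k.1 ≠ l'.1 := fun h => hkl (Fin.ext h)
            refine ⟨fun h => ?_, fun h => ?_, fun h => ?_, fun h => ?_⟩ <;>
            · have := congrArg Fin.val (σ.injective h)
              simp only at this
              omega)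
        have hmap : ∀ i j : Fin n, i ≠ j →
            μ.map (fun ω => (W i ω, W j ω)) = ν.prod ν := by
          intro i j hij
          rw [(indepFun_iff_map_prod_eq_prod_map_map (hWm i).aemeasurable
            (hWm j).aemeasurable).1 (hW.indepFun hij), hlaw, hlaw]
        have hne : ∀ k : Fin m, σ ⟨2 * k.1, by omega⟩ ≠ σ ⟨2 * k.1 + 1, by omega⟩ := by
          intro k h
          have := congrArg Fin.val (σ.injective h)
          simp at this
        refine average_mgf_le hm0 (hpair.comp (fun _ => F) fun _ => hF)
          (fun k => hF.comp ((hWm _).prodMk (hWm _))) (fun k ω => hb _) (fun k => ?_) (fun k => ?_)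
          hl hlb
        · refine le_trans (le_of_eq ?_) hv
          rw [← hmap _ _ (hne k), integral_map ((hWm _).prodMk (hWm _)).aemeasurable
            (hF.pow_const 2).aestronglyMeasurable]
          rfl
        · change _ = ∫ w, F w ∂(ν.prod ν)
          rw [← hmap _ _ (hne k), integral_map ((hWm _).prodMk (hWm _)).aemeasurable
            hF.aestronglyMeasurable]
          rfl
    _ = _ := by rw [← Finset.sum_mul, hw, one_mul]

/-- Bernstein's inequality for `U`-statistics of order two. -/
theorem bernstein_uStatistic {E : Type*} [MeasurableSpace E] {n m : ℕ} (hm0 : 0 < m)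
    (hmn : 2 * m ≤ n) {W : Fin n → Ω → E} (hW : iIndepFun W μ) (hWm : ∀ i, Measurable (W i))
    {ν : Measure E} (hlaw : ∀ i, μ.map (W i) = ν) {F : E × E → ℝ} (hF : Measurable F)
    {b v x : ℝ} (hb : ∀ w, |F w| ≤ b) (hv : ∫ w, F w ^ 2 ∂(ν.prod ν) ≤ v) (hb0 : 0 ≤ b)
    (hv0 : 0 < v) (hx : 0 < x) :
    μ.real {ω | x ≤ |(1 / ((n : ℝ) * (n - 1))) *
        ∑ q ∈ Finset.univ.offDiag, F (W q.1 ω, W q.2 ω) - ∫ w, F w ∂(ν.prod ν)|} ≤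
      2 * Real.exp (-(m * x ^ 2 / (2 * v + 2 / 3 * b * x))) := by
  have hint : ∀ l, Integrable (fun ω => Real.exp (l * ((1 / ((n : ℝ) * (n - 1))) *
        ∑ q ∈ (Finset.univ : Finset (Fin n)).offDiag, F (W q.1 ω, W q.2 ω)
          - ∫ w, F w ∂(ν.prod ν)))) μ := by
    refine integrable_exp_of_abs_le
      (b := |1 / ((n : ℝ) * (n - 1))| * ∑ q ∈ (Finset.univ : Finset (Fin n)).offDiag, b
        + |∫ w, F w ∂(ν.prod ν)|)
      (((Finset.measurable_sum _ fun q _ =>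
        hF.comp ((hWm _).prodMk (hWm _))).const_mul _).sub_const _) fun ω => ?_
    refine (abs_sub _ _).trans (add_le_add ?_ le_rfl)
    rw [abs_mul]
    refine mul_le_mul_of_nonneg_left ?_ (abs_nonneg _)
    exact (Finset.abs_sum_le_sum_abs _ _).trans (Finset.sum_le_sum fun q _ => hb _)
  refine measureReal_abs_ge_le ?_ ?_
  · exact measureReal_ge_le_of_mgf_le hm0 hb0 hv0 hx hint fun l hl hlb =>
      uStatistic_mgf_le hm0 hmn hW hWm hlaw hF hb hv hl hlb
  · refine measureReal_ge_le_of_mgf_le hm0 hb0 hv0 hx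
      (fun l => by simpa only [neg_mul_comm] using hint (-l)) fun l hl hlb => ?_
    have := uStatistic_mgf_le (l := l) (b := b) (v := v) hm0 hmn hW hWm hlaw
      (F := fun w => - F w) hF.neg (by simpa using hb) (by simpa using hv) hl hlb
    refine le_trans (le_of_eq ?_) this
    refine integral_congr_ae (Filter.Eventually.of_forall fun ω => ?_)
    simp only [Finset.sum_neg_distrib, integral_neg]
    congr 1
    ring

end

/-! ### Taylor expansions along a segment -/

/-- Induction on `α`: the derivative of the remainder is the remainder of the shifted family, and
the mean value inequality compares it with the derivative of `M r ^ (α + 1) / (α + 1)!`. No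
continuity of the top derivative is needed. -/
lemma taylor_remainder_le {α : ℕ} : ∀ {c : ℕ → ℝ → ℝ} {M : ℝ},
    (∀ k < α, ∀ r, HasDerivAt (c k) (c (k + 1) r) r) →
    (∀ r ∈ Icc (0 : ℝ) 1, |c α r| ≤ M) → ∀ r ∈ Icc (0 : ℝ) 1,
    |c 0 r - ∑ k ∈ Finset.range α, c k 0 * r ^ k / (k.factorial : ℝ)| ≤
      M * r ^ α / (α.factorial : ℝ) := by
  induction α with
  | zero => intro c M _ hM r hr; simpa using hM r hr
  | succ α ih =>
    intro c M hc hM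
    have hih := ih (c := fun k => c (k + 1)) (M := M) (fun k hk r => hc (k + 1) (by omega) r) hM
    have hg : ∀ r, HasDerivAt
        (fun r => c 0 r - ∑ k ∈ Finset.range (α + 1), c k 0 * r ^ k / (k.factorial : ℝ))
        (c 1 r - ∑ k ∈ Finset.range α, c (k + 1) 0 * r ^ k / (k.factorial : ℝ)) r := by
      intro r
      have hs : HasDerivAt
          (fun r : ℝ => ∑ k ∈ Finset.range (α + 1), c k 0 * r ^ k / (k.factorial : ℝ))
          (∑ k ∈ Finset.range (α + 1), c k 0 * (k * r ^ (k - 1)) / (k.factorial : ℝ)) r :=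
        HasDerivAt.fun_sum fun k _ => ((hasDerivAt_pow k r).const_mul _).div_const _
      have h2 := (hc 0 (by omega) r).sub hs
      refine h2.congr_deriv ?_
      rw [Finset.sum_range_succ']
      congr 1
      simp only [Nat.cast_zero, zero_mul, mul_zero, zero_div, add_zero]
      refine Finset.sum_congr rfl fun k _ => ?_
      rw [Nat.factorial_succ, Nat.add_sub_cancel]
      push_cast
      have : ((k : ℝ) + 1) ≠ 0 := by positivity
      field_simp
    have hB : ∀ r : ℝ, HasDerivAt (fun r => M * r ^ (α + 1) / ((α + 1).factorial : ℝ))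
        (M * r ^ α / (α.factorial : ℝ)) r := by
      intro r
      have := ((hasDerivAt_pow (α + 1) r).const_mul M).div_const ((α + 1).factorial : ℝ)
      refine this.congr_deriv ?_
      rw [Nat.factorial_succ, Nat.add_sub_cancel]
      push_cast
      have : ((α : ℝ) + 1) ≠ 0 := by positivity
      field_simp
    refine image_norm_le_of_norm_deriv_right_le_deriv_boundary
      (fun r _ => (hg r).continuousAt.continuousWithinAt) (fun r _ => (hg r).hasDerivWithinAt)
      ?_ hB fun r hr => hih r ⟨hr.1, hr.2.le⟩
    rw [Finset.sum_range_succ']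
    simp

/-- Stated in `[0, ∞]` so that the suprema in the smoothness assumptions may be infinite at some
points. -/
lemma ofReal_taylor_remainder_le {α : ℕ} {c : ℕ → ℝ → ℝ} {B : ENNReal}
    (hc : ∀ k < α, ∀ r, HasDerivAt (c k) (c (k + 1) r) r)
    (hB : ∀ r ∈ Icc (0 : ℝ) 1, ENNReal.ofReal |c α r| ≤ B) :
    ENNReal.ofReal |c 0 1 - ∑ k ∈ Finset.range α, c k 0 / (k.factorial : ℝ)| ≤
      ENNReal.ofReal (1 / (α.factorial : ℝ)) * B := by
  have hfac : 0 < 1 / (α.factorial : ℝ) := by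
    have : (0 : ℝ) < α.factorial := by exact_mod_cast α.factorial_pos
    positivity
  rcases eq_or_ne B ⊤ with rfl | hBtop
  · rw [ENNReal.mul_top (by simpa using α.factorial_ne_zero)]
    exact le_top
  · have h1 := taylor_remainder_le (M := B.toReal) hc
      (fun r hr => (ENNReal.ofReal_le_iff_le_toReal hBtop).1 (hB r hr)) 1 (by simp)
    simp only [one_pow, mul_one] at h1
    rw [← ENNReal.ofReal_toReal hBtop, ← ENNReal.ofReal_mul hfac.le]
    refine ENNReal.ofReal_le_ofReal (h1.trans (le_of_eq ?_))
    ring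

section
variable {p : ℕ}

/-- The `k`-th derivative of `r ↦ F (z + r w)`. -/
noncomputable def segmentDeriv (F : (Fin p → ℝ) → ℝ) (z w : Fin p → ℝ) (k : ℕ) (r : ℝ) : ℝ :=
  iteratedFDeriv ℝ k F (z + r • w) fun _ => w

lemma segmentDeriv_zero (F : (Fin p → ℝ) → ℝ) (z w : Fin p → ℝ) (r : ℝ) :
    segmentDeriv F z w 0 r = F (z + r • w) := by
  simp [segmentDeriv]

lemma hasDerivAt_segmentDeriv {F : (Fin p → ℝ) → ℝ} {α k : ℕ} (hF : TimesDifferentiable α F)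
    (hk : k < α) (z w : Fin p → ℝ) (r : ℝ) :
    HasDerivAt (segmentDeriv F z w k) (segmentDeriv F z w (k + 1) r) r := by
  have h1 := (hF k hk (z + r • w)).hasFDerivAt
  have h2 : HasDerivAt (fun r : ℝ => z + r • w) w r := by
    simpa using ((hasDerivAt_id r).smul_const w).const_add z
  have h3 := h1.comp_hasDerivAt r h2
  exact (ContinuousMultilinearMap.apply ℝ (fun _ : Fin k => Fin p → ℝ) ℝ
    (fun _ => w)).hasFDerivAt.comp_hasDerivAt r h3

/-- Multilinearity of the iterated derivative, applied to `u` written in the standard basis. The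
factor `h ^ k` is the source of the bias order. -/
lemma segmentDeriv_smul (F : (Fin p → ℝ) → ℝ) (z u : Fin p → ℝ) (h : ℝ) (k : ℕ) (r : ℝ) :
    segmentDeriv F z (h • u) k r =
      h ^ k * ∑ idx : Fin k → Fin p, (∏ l, u (idx l)) * partialD F idx (z + (r * h) • u) := by
  unfold segmentDeriv partialD
  rw [smul_smul]
  set T := iteratedFDeriv ℝ k F (z + (r * h) • u)
  have hu : u = ∑ i, u i • (Pi.single i 1 : Fin p → ℝ) := by
    ext j; simp [Finset.sum_apply, Pi.single_apply]
  have h1 : (T fun _ => h • u) = h ^ k * T fun _ => u := by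
    have := T.map_smul_univ (fun _ => h) (fun _ => u)
    simpa using this
  rw [h1]
  congr 1
  conv_lhs => rw [hu]
  rw [show (T fun _ => ∑ i, u i • (Pi.single i 1 : Fin p → ℝ)) =
    T.toMultilinearMap fun _ => ∑ i, u i • (Pi.single i 1 : Fin p → ℝ) from rfl,
    MultilinearMap.map_sum]
  refine Finset.sum_congr rfl fun idx _ => ?_
  have := T.map_smul_univ (fun l => u (idx l)) (fun l => (Pi.single (idx l) 1 : Fin p → ℝ))
  simpa using this

/-- Leibniz' rule for families of successive derivatives. -/
lemma hasDerivAt_leibniz {a b : ℕ → ℝ → ℝ} {α k : ℕ}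
    (ha : ∀ k < α, ∀ r, HasDerivAt (a k) (a (k + 1) r) r)
    (hb : ∀ k < α, ∀ r, HasDerivAt (b k) (b (k + 1) r) r) (hk : k < α) (r : ℝ) :
    HasDerivAt
      (fun r => ∑ q ∈ Finset.HasAntidiagonal.antidiagonal k, (k.choose q.1 : ℝ) * (a q.1 r * b q.2 r))
      (∑ q ∈ Finset.HasAntidiagonal.antidiagonal (k + 1), ((k + 1).choose q.1 : ℝ) * (a q.1 r * b q.2 r)) r := by
  have h1 : HasDerivAt
      (fun r => ∑ q ∈ Finset.HasAntidiagonal.antidiagonal k, (k.choose q.1 : ℝ) * (a q.1 r * b q.2 r))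
      (∑ q ∈ Finset.HasAntidiagonal.antidiagonal k, (k.choose q.1 : ℝ) *
        (a (q.1 + 1) r * b q.2 r + a q.1 r * b (q.2 + 1) r)) r := by
    refine HasDerivAt.fun_sum fun q hq => HasDerivAt.const_mul _ ?_
    have := Finset.HasAntidiagonal.mem_antidiagonal.1 hq
    exact (ha q.1 (by omega) r).mul (hb q.2 (by omega) r)
  refine h1.congr_deriv ?_
  have := Finset.sum_antidiagonal_choose_succ_mul (fun i j => a i r * b j r) k
  rw [this, ← Finset.sum_add_distrib]
  symm
  refine Finset.sum_congr rfl fun q hq => ?_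
  -- One of the two sums produced by Pascal's rule carries the binomial coefficient with the
  -- complementary lower index.
  have h2 : k.choose q.2 = k.choose q.1 := by
    have := Finset.HasAntidiagonal.mem_antidiagonal.1 hq
    exact Nat.choose_symm_of_eq_add (by omega)
  rw [h2]
  ring

/-- Concatenation of multi-indices is bijective. This turns the double sum from a product of two
derivatives into the single sum over `ι` used in the joint smoothness bound. -/
lemma sum_headIdx_tailIdx {R : Type*} [AddCommMonoid R] {α : ℕ} (k : Fin (α + 1))
    (G : (Fin k.1 → Fin p) → (Fin (α - k.1) → Fin p) → R) :
    ∑ i, ∑ j, G i j = ∑ idx : Fin α → Fin p, G (headIdx idx k) (tailIdx idx k) := by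
  rw [← Fintype.sum_prod_type']
  symm
  refine Fintype.sum_bijective (fun idx => (headIdx idx k, tailIdx idx k)) ⟨?_, ?_⟩ _ _
    fun _ => rfl
  · intro i j hij
    funext l
    have h1 := congrArg Prod.fst hij
    have h2 := congrArg Prod.snd hij
    by_cases hl : l.1 < k.1
    · simpa [headIdx] using congrFun h1 ⟨l.1, hl⟩
    · have := congrFun h2 ⟨l.1 - k.1, by omega⟩
      simpa [tailIdx, Nat.add_sub_cancel' (not_lt.1 hl)] using this
  · rintro ⟨i, j⟩
    refine ⟨fun l => if hl : l.1 < k.1 then i ⟨l.1, hl⟩ else j ⟨l.1 - k.1, by omega⟩, ?_⟩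
    refine Prod.ext (funext fun l => ?_) (funext fun l => ?_)
    · simp [headIdx]
    · simp [tailIdx]

lemma ofReal_abs_sum_le {ι : Type*} (s : Finset ι) (y : ι → ℝ) :
    ENNReal.ofReal |∑ i ∈ s, y i| ≤ ∑ i ∈ s, ENNReal.ofReal |y i| := by
  rw [← ENNReal.ofReal_sum_of_nonneg fun _ _ => abs_nonneg _]
  exact ENNReal.ofReal_le_ofReal (Finset.abs_sum_le_sum_abs _ _)

/-- The role of `h ≤ 1`: intermediate points `z + (r h) u` stay on the segment over which the
suprema are taken. -/
lemma mul_mem_Icc {r h : ℝ} (hr : r ∈ Icc (0 : ℝ) 1) (hh : 0 < h) (hh1 : h ≤ 1) :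
    r * h ∈ Icc (0 : ℝ) 1 :=
  ⟨mul_nonneg hr.1 hh.le, mul_le_one₀ hr.2 hh.le hh1⟩

/-- Taylor's formula for one function. -/
lemma ofReal_taylor_single_le {α : ℕ} {F : (Fin p → ℝ) → ℝ} (hF : TimesDifferentiable α F)
    (z u : Fin p → ℝ) {h : ℝ} (hh : 0 < h) (hh1 : h ≤ 1) :
    ENNReal.ofReal |F (z + h • u) -
        ∑ k ∈ Finset.range α, segmentDeriv F z (h • u) k 0 / (k.factorial : ℝ)| ≤
      ENNReal.ofReal (h ^ α / (α.factorial : ℝ)) * ∑ idx : Fin α → Fin p,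
        ENNReal.ofReal |∏ l, u (idx l)| *
          ⨆ t ∈ Icc (0 : ℝ) 1, ENNReal.ofReal |partialD F idx (z + t • u)| := by
  set S := ∑ idx : Fin α → Fin p, ENNReal.ofReal |∏ l, u (idx l)| *
          ⨆ t ∈ Icc (0 : ℝ) 1, ENNReal.ofReal |partialD F idx (z + t • u)|
  have h1 := ofReal_taylor_remainder_le (c := segmentDeriv F z (h • u)) (α := α)
    (B := ENNReal.ofReal (h ^ α) * S) (fun k hk r => hasDerivAt_segmentDeriv hF hk _ _ r) (by
      intro r hr
      rw [segmentDeriv_smul, abs_mul, abs_of_pos (by positivity),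
        ENNReal.ofReal_mul (by positivity)]
      gcongr
      refine (ofReal_abs_sum_le _ _).trans (Finset.sum_le_sum fun idx _ => ?_)
      rw [abs_mul, ENNReal.ofReal_mul (abs_nonneg _)]
      gcongr
      exact le_iSup₂ (f := fun t (_ : t ∈ Icc (0 : ℝ) 1) =>
        ENNReal.ofReal |partialD F idx (z + t • u)|) (r * h) (mul_mem_Icc hr hh hh1))
  rw [segmentDeriv_zero, one_smul] at h1
  refine h1.trans (le_of_eq ?_)
  rw [← mul_assoc, ← ENNReal.ofReal_mul (by positivity)]
  congr 2
  ring

/-- Taylor's formula for a product of two functions. -/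
lemma ofReal_taylor_product_le {α : ℕ} {f : ℝ × ℝ → (Fin p → ℝ) → ℝ} {x₁ x₂ : ℝ × ℝ}
    (hF : TimesDifferentiable α (f x₁)) (hG : TimesDifferentiable α (f x₂))
    (z u v : Fin p → ℝ) {h : ℝ} (hh : 0 < h) (hh1 : h ≤ 1) :
    ENNReal.ofReal |f x₁ (z + h • u) * f x₂ (z + h • v) -
        ∑ k ∈ Finset.range α, (∑ q ∈ Finset.HasAntidiagonal.antidiagonal k, (k.choose q.1 : ℝ) *
          (segmentDeriv (f x₁) z (h • u) q.1 0 * segmentDeriv (f x₂) z (h • v) q.2 0)) /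
            (k.factorial : ℝ)| ≤
      ENNReal.ofReal (h ^ α / (α.factorial : ℝ)) *
        ∑ k : Fin (α + 1), (α.choose k.1 : ENNReal) * ∑ idx : Fin α → Fin p,
          derivativeSup f k idx u v x₁ x₂ z *
            ENNReal.ofReal |(∏ l, u (headIdx idx k l)) * ∏ l, v (tailIdx idx k l)| := by
  set S := ∑ k : Fin (α + 1), (α.choose k.1 : ENNReal) * ∑ idx : Fin α → Fin p,
          derivativeSup f k idx u v x₁ x₂ z *
            ENNReal.ofReal |(∏ l, u (headIdx idx k l)) * ∏ l, v (tailIdx idx k l)|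
  have h1 := ofReal_taylor_remainder_le
    (c := fun k r => ∑ q ∈ Finset.HasAntidiagonal.antidiagonal k, (k.choose q.1 : ℝ) *
          (segmentDeriv (f x₁) z (h • u) q.1 r * segmentDeriv (f x₂) z (h • v) q.2 r)) (α := α)
    (B := ENNReal.ofReal (h ^ α) * S) (fun k hk r => hasDerivAt_leibniz
      (fun k hk r => hasDerivAt_segmentDeriv hF hk _ _ r)
      (fun k hk r => hasDerivAt_segmentDeriv hG hk _ _ r) hk r) (by
      intro r hr
      have e1 : ∑ q ∈ Finset.HasAntidiagonal.antidiagonal α, (α.choose q.1 : ℝ) *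
          (segmentDeriv (f x₁) z (h • u) q.1 r * segmentDeriv (f x₂) z (h • v) q.2 r) =
          h ^ α * ∑ k : Fin (α + 1), (α.choose k.1 : ℝ) * ∑ idx : Fin α → Fin p,
            (partialD (f x₁) (headIdx idx k) (z + (r * h) • u) *
              partialD (f x₂) (tailIdx idx k) (z + (r * h) • v)) *
            ((∏ l, u (headIdx idx k l)) * ∏ l, v (tailIdx idx k l)) := by
        rw [Finset.Nat.sum_antidiagonal_eq_sum_range_succ_mk, Finset.sum_range, Finset.mul_sum]
        refine Finset.sum_congr rfl fun k _ => ?_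
        simp only
        rw [segmentDeriv_smul, segmentDeriv_smul]
        have hk : h ^ α = h ^ k.1 * h ^ (α - k.1) := by
          rw [← pow_add]; congr 1; omega
        rw [← sum_headIdx_tailIdx k (fun i j =>
          (partialD (f x₁) i (z + (r * h) • u) * partialD (f x₂) j (z + (r * h) • v)) *
            ((∏ l, u (i l)) * ∏ l, v (j l))), hk]
        have e2 : ∑ i : Fin k.1 → Fin p, ∑ j : Fin (α - k.1) → Fin p,
            (partialD (f x₁) i (z + (r * h) • u) * partialD (f x₂) j (z + (r * h) • v)) *
            ((∏ l, u (i l)) * ∏ l, v (j l)) =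
            (∑ i : Fin k.1 → Fin p, (∏ l, u (i l)) * partialD (f x₁) i (z + (r * h) • u)) *
            ∑ j : Fin (α - k.1) → Fin p,
              (∏ l, v (j l)) * partialD (f x₂) j (z + (r * h) • v) := by
          rw [Finset.sum_mul_sum]
          exact Finset.sum_congr rfl fun i _ => Finset.sum_congr rfl fun j _ => by ring
        rw [e2]
        ring
      rw [e1, abs_mul, abs_of_pos (by positivity), ENNReal.ofReal_mul (by positivity)]
      gcongr
      refine (ofReal_abs_sum_le _ _).trans (Finset.sum_le_sum fun k _ => ?_)
      rw [abs_mul, Nat.abs_cast, ENNReal.ofReal_mul (Nat.cast_nonneg _), ENNReal.ofReal_natCast]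
      gcongr
      refine (ofReal_abs_sum_le _ _).trans (Finset.sum_le_sum fun idx _ => ?_)
      rw [abs_mul, ENNReal.ofReal_mul (abs_nonneg _)]
      gcongr
      exact le_iSup₂ (f := fun t (_ : t ∈ Icc (0 : ℝ) 1) => ENNReal.ofReal
        |partialD (f x₁) (headIdx idx k) (z + t • u) * partialD (f x₂) (tailIdx idx k) (z + t • v)|)
        (r * h) (mul_mem_Icc hr hh hh1))
  simp only [Finset.Nat.antidiagonal_zero, Finset.sum_singleton, Nat.choose_self, Nat.cast_one,
    one_mul, segmentDeriv_zero, one_smul] at h1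
  refine h1.trans (le_of_eq ?_)
  rw [← mul_assoc, ← ENNReal.ofReal_mul (by positivity)]
  congr 2
  ring

/-! ### Bias of kernel smoothing -/

/-- At `r = 0` the derivative is a homogeneous polynomial in `u` of degree `k < α`, so only moments
of `K` occur. -/
lemma integrable_kernel_mul_segmentDeriv {K : (Fin p → ℝ) → ℝ} {α : ℕ} (hK : IsKernelOfOrder K α)
    (F : (Fin p → ℝ) → ℝ) (z : Fin p → ℝ) (h : ℝ) {k : ℕ} (hk : k < α) :
    Integrable fun u => K u * segmentDeriv F z (h • u) k 0 := by
  simp_rw [segmentDeriv_smul, Finset.mul_sum]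
  refine integrable_finsetSum _ fun idx _ => ?_
  have h1 : Integrable fun u => K u * ∏ l, u (idx l) := by
    rcases Nat.eq_zero_or_pos k with rfl | hk0
    · simpa using hK.integrable
    · exact hK.moment_integrable k hk0 (by omega) idx
  refine (h1.mul_const (h ^ k * partialD F idx z)).congr (Filter.Eventually.of_forall fun u => ?_)
  simp only [zero_mul, zero_smul, add_zero]
  ring

lemma integral_kernel_mul_segmentDeriv {K : (Fin p → ℝ) → ℝ} {α : ℕ} (hK : IsKernelOfOrder K α)
    (F : (Fin p → ℝ) → ℝ) (z : Fin p → ℝ) (h : ℝ) {k : ℕ} (hk : k < α) :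
    ∫ u, K u * segmentDeriv F z (h • u) k 0 = if k = 0 then F z else 0 := by
  split_ifs with hk0
  · subst hk0
    simp_rw [segmentDeriv_zero, zero_smul, add_zero]
    rw [integral_mul_const, hK.integral_eq_one, one_mul]
  · simp_rw [segmentDeriv_smul]
    have h1 : ∀ u, K u * (h ^ k * ∑ idx : Fin k → Fin p,
        (∏ l, u (idx l)) * partialD F idx (z + ((0 : ℝ) * h) • u)) =
        ∑ idx : Fin k → Fin p, (K u * ∏ l, u (idx l)) * (h ^ k * partialD F idx z) := by
      intro u
      rw [Finset.mul_sum, Finset.mul_sum]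
      refine Finset.sum_congr rfl fun idx _ => ?_
      simp only [zero_mul, zero_smul, add_zero]
      ring
    simp_rw [h1]
    rw [integral_finsetSum _ fun idx _ =>
      (hK.moment_integrable k (by omega) (by omega) idx).mul_const _]
    refine Finset.sum_eq_zero fun idx _ => ?_
    rw [integral_mul_const, hK.moment_eq_zero k (by omega) (by omega), zero_mul]

lemma ofReal_abs_integral_le {E : Type*} [MeasurableSpace E] {μ : Measure E} (g : E → ℝ) :
    ENNReal.ofReal |∫ x, g x ∂μ| ≤ ∫⁻ x, ENNReal.ofReal |g x| ∂μ := by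
  have := enorm_integral_le_lintegral_enorm (μ := μ) g
  simpa only [Real.enorm_eq_ofReal_abs] using this

/-- The Taylor polynomial of degree below `α` integrates against `K` to `F z`, since the
intermediate moments vanish. Only the remainder is left. -/
lemma kernel_bias_single {K : (Fin p → ℝ) → ℝ} {α : ℕ} (hK : IsKernelOfOrder K α)
    {F : (Fin p → ℝ) → ℝ} (hF : TimesDifferentiable α F) (z : Fin p → ℝ) {h : ℝ} (hh : 0 < h)
    (hh1 : h ≤ 1) (hint : Integrable fun u => K u * F (z + h • u)) :
    ENNReal.ofReal |(∫ u, K u * F (z + h • u)) - F z| ≤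
      ENNReal.ofReal (h ^ α / (α.factorial : ℝ)) *
        ∫⁻ u, ENNReal.ofReal |K u| * ∑ idx : Fin α → Fin p, ENNReal.ofReal |∏ l, u (idx l)| *
          ⨆ t ∈ Icc (0 : ℝ) 1, ENNReal.ofReal |partialD F idx (z + t • u)| := by
  have hα := hK.one_lt
  have hpoly : ∀ k ∈ Finset.range α, Integrable fun u =>
      K u * segmentDeriv F z (h • u) k 0 / (k.factorial : ℝ) := fun k hk =>
    (integrable_kernel_mul_segmentDeriv hK F z h (Finset.mem_range.1 hk)).div_const _
  have hsum : ∑ k ∈ Finset.range α, ∫ u, K u * segmentDeriv F z (h • u) k 0 /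
      (k.factorial : ℝ) = F z := by
    have : ∀ k ∈ Finset.range α, ∫ u, K u * segmentDeriv F z (h • u) k 0 / (k.factorial : ℝ) =
        if k = 0 then F z else 0 := by
      intro k hk
      rw [integral_div, integral_kernel_mul_segmentDeriv hK F z h (Finset.mem_range.1 hk)]
      split_ifs with h0
      · simp [h0]
      · simp
    rw [Finset.sum_congr rfl this, Finset.sum_ite_eq' _ 0 fun _ => F z,
      if_pos (Finset.mem_range.2 (by omega))]
  have heq : (∫ u, K u * F (z + h • u)) - F z = ∫ u, K u * (F (z + h • u) -
      ∑ k ∈ Finset.range α, segmentDeriv F z (h • u) k 0 / (k.factorial : ℝ)) := by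
    conv_lhs => rw [← hsum]
    rw [← integral_finsetSum _ hpoly, ← integral_sub hint (integrable_finsetSum _ hpoly)]
    refine integral_congr_ae (Filter.Eventually.of_forall fun u => ?_)
    simp only [mul_sub, Finset.mul_sum, mul_div_assoc]
  rw [heq]
  refine (ofReal_abs_integral_le _).trans ?_
  rw [← lintegral_const_mul' _ _ ENNReal.ofReal_ne_top]
  refine lintegral_mono fun u => ?_
  rw [abs_mul, ENNReal.ofReal_mul (abs_nonneg _), mul_left_comm]
  gcongr
  exact ofReal_taylor_single_le hF z u hh hh1

/-- The product is expanded as one function along a joint segment in `(u, v)`. Each Taylor term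
factorises into two kernel moments, at least one of which vanishes unless both orders are zero. -/
lemma kernel_bias_product {K : (Fin p → ℝ) → ℝ} {α : ℕ} (hK : IsKernelOfOrder K α)
    {f : ℝ × ℝ → (Fin p → ℝ) → ℝ} {x₁ x₂ : ℝ × ℝ} (hF : TimesDifferentiable α (f x₁))
    (hG : TimesDifferentiable α (f x₂)) (z : Fin p → ℝ) {h : ℝ} (hh : 0 < h) (hh1 : h ≤ 1)
    (hint₁ : Integrable fun u => K u * f x₁ (z + h • u))
    (hint₂ : Integrable fun u => K u * f x₂ (z + h • u)) :
    ENNReal.ofReal |(∫ u, K u * f x₁ (z + h • u)) * (∫ u, K u * f x₂ (z + h • u)) -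
        f x₁ z * f x₂ z| ≤
      ENNReal.ofReal (h ^ α / (α.factorial : ℝ)) *
        ∫⁻ w : (Fin p → ℝ) × (Fin p → ℝ), ENNReal.ofReal (|K w.1| * |K w.2|) *
        ∑ k : Fin (α + 1), (α.choose k.1 : ENNReal) * ∑ idx : Fin α → Fin p,
          derivativeSup f k idx w.1 w.2 x₁ x₂ z *
            ENNReal.ofReal |(∏ l, w.1 (headIdx idx k l)) * ∏ l, w.2 (tailIdx idx k l)| := by
  have hα := hK.one_lt
  set P : ℕ → ℕ × ℕ → (Fin p → ℝ) × (Fin p → ℝ) → ℝ := fun k q w =>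
    ((k.choose q.1 : ℝ) / (k.factorial : ℝ)) * ((K w.1 * segmentDeriv (f x₁) z (h • w.1) q.1 0) *
      (K w.2 * segmentDeriv (f x₂) z (h • w.2) q.2 0)) with hP
  have hPint : ∀ k ∈ Finset.range α, ∀ q ∈ Finset.HasAntidiagonal.antidiagonal k, Integrable (P k q) := by
    intro k hk q hq
    have h1 := Finset.mem_range.1 hk
    have h2 := Finset.HasAntidiagonal.mem_antidiagonal.1 hq
    exact (((integrable_kernel_mul_segmentDeriv hK (f x₁) z h (by omega : q.1 < α)).mul_prod
      (integrable_kernel_mul_segmentDeriv hK (f x₂) z h (by omega : q.2 < α))).const_mul _)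
  have hPval : ∀ k ∈ Finset.range α, ∀ q ∈ Finset.HasAntidiagonal.antidiagonal k,
      ∫ w, P k q w = if k = 0 then f x₁ z * f x₂ z else 0 := by
    intro k hk q hq
    have h1 := Finset.mem_range.1 hk
    have h2 := Finset.HasAntidiagonal.mem_antidiagonal.1 hq
    simp only [hP]
    rw [integral_const_mul]
    have h3 := integral_prod_mul (μ := (volume : Measure (Fin p → ℝ)))
      (ν := (volume : Measure (Fin p → ℝ)))
      (fun u => K u * segmentDeriv (f x₁) z (h • u) q.1 0)
      (fun u => K u * segmentDeriv (f x₂) z (h • u) q.2 0)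
    rw [integral_kernel_mul_segmentDeriv hK _ z h (by omega : q.1 < α),
      integral_kernel_mul_segmentDeriv hK _ z h (by omega : q.2 < α)] at h3
    rw [Measure.volume_eq_prod, h3]
    by_cases hk0 : k = 0
    · have e1 : q.1 = 0 := by omega
      have e2 : q.2 = 0 := by omega
      simp [hk0, e1, e2]
    · by_cases e1 : q.1 = 0
      · have e2 : q.2 ≠ 0 := by omega
        simp [hk0, e2]
      · simp [hk0, e1]
  have hsum : ∫ w, ∑ k ∈ Finset.range α, ∑ q ∈ Finset.HasAntidiagonal.antidiagonal k, P k q w =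
      f x₁ z * f x₂ z := by
    rw [integral_finsetSum _ fun k hk => integrable_finsetSum _ (hPint k hk)]
    have : ∀ k ∈ Finset.range α, ∫ w, ∑ q ∈ Finset.HasAntidiagonal.antidiagonal k, P k q w =
        if k = 0 then f x₁ z * f x₂ z else 0 := by
      intro k hk
      rw [integral_finsetSum _ (hPint k hk), Finset.sum_congr rfl (hPval k hk)]
      split_ifs with h0
      · subst h0; simp
      · simp
    rw [Finset.sum_congr rfl this, Finset.sum_ite_eq' _ 0 fun _ => f x₁ z * f x₂ z,
      if_pos (Finset.mem_range.2 (by omega))]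
  have hprod := integral_prod_mul (μ := (volume : Measure (Fin p → ℝ)))
      (ν := (volume : Measure (Fin p → ℝ)))
      (fun u => K u * f x₁ (z + h • u)) (fun u => K u * f x₂ (z + h • u))
  have heq : (∫ u, K u * f x₁ (z + h • u)) * (∫ u, K u * f x₂ (z + h • u)) -
        f x₁ z * f x₂ z = ∫ w : (Fin p → ℝ) × (Fin p → ℝ), (K w.1 * K w.2) *
        (f x₁ (z + h • w.1) * f x₂ (z + h • w.2) -
        ∑ k ∈ Finset.range α, (∑ q ∈ Finset.HasAntidiagonal.antidiagonal k, (k.choose q.1 : ℝ) *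
          (segmentDeriv (f x₁) z (h • w.1) q.1 0 * segmentDeriv (f x₂) z (h • w.2) q.2 0)) /
            (k.factorial : ℝ)) := by
    conv_lhs => rw [← hsum]
    rw [← hprod, Measure.volume_eq_prod, ← integral_sub (hint₁.mul_prod hint₂)
      (integrable_finsetSum _ fun k hk => integrable_finsetSum _ (hPint k hk))]
    refine integral_congr_ae (Filter.Eventually.of_forall fun w => ?_)
    simp only [hP, mul_sub, Finset.mul_sum, Finset.sum_div]
    congr 1
    · ring
    · exact Finset.sum_congr rfl fun k _ => Finset.sum_congr rfl fun q _ => by ring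
  rw [heq]
  refine (ofReal_abs_integral_le _).trans ?_
  rw [← lintegral_const_mul' _ _ ENNReal.ofReal_ne_top]
  refine lintegral_mono fun w => ?_
  rw [abs_mul, abs_mul, ENNReal.ofReal_mul (by positivity), mul_left_comm]
  gcongr
  exact ofReal_taylor_product_le hF hG z w.1 w.2 hh hh1

end

/-! ### Conditional Kendall's tau as an expectation of `gStar` -/

section
variable (ν : Measure (ℝ × ℝ)) [IsProbabilityMeasure ν]

lemma volume_fst_eq (c : ℝ) : (volume : Measure (ℝ × ℝ)) {y | y.1 = c} = 0 := by
  have : {y : ℝ × ℝ | y.1 = c} = ({c} : Set ℝ) ×ˢ (univ : Set ℝ) := by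
    ext y; simp
  rw [this, Measure.volume_eq_prod, Measure.prod_prod]
  simp

lemma volume_snd_eq (c : ℝ) : (volume : Measure (ℝ × ℝ)) {y | y.2 = c} = 0 := by
  have : {y : ℝ × ℝ | y.2 = c} = (univ : Set ℝ) ×ˢ ({c} : Set ℝ) := by
    ext y; simp
  rw [this, Measure.volume_eq_prod, Measure.prod_prod]
  simp

/-- For a fixed first point, a tie confines the second one to two coordinate lines, which are
Lebesgue null. -/
lemma ae_no_ties (hν : ν ≪ volume) :
    ∀ᵐ w ∂(ν.prod ν), (w.1.1 - w.2.1) * (w.1.2 - w.2.2) ≠ 0 := by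
  have h1 : MeasurableSet {w : (ℝ × ℝ) × (ℝ × ℝ) | ¬ (w.1.1 - w.2.1) * (w.1.2 - w.2.2) ≠ 0} := by
    simp only [ne_eq, not_not]
    exact measurableSet_eq_fun (by fun_prop) (by fun_prop)
  rw [ae_iff, Measure.measure_prod_null h1]
  refine Filter.Eventually.of_forall fun x => ?_
  refine hν (measure_mono_null (t := {y | y.1 = x.1} ∪ {y | y.2 = x.2}) ?_
    (measure_union_null (volume_fst_eq _) (volume_snd_eq _)))
  intro y hy
  have hy' : ¬ (x.1 - y.1) * (x.2 - y.2) ≠ 0 := hy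
  simp only [ne_eq, not_not, mul_eq_zero, sub_eq_zero] at hy'
  exact hy'.imp Eq.symm Eq.symm

lemma measurableSet_concordant :
    MeasurableSet {w : (ℝ × ℝ) × (ℝ × ℝ) | 0 < (w.1.1 - w.2.1) * (w.1.2 - w.2.2)} :=
  measurableSet_lt (by fun_prop) (by fun_prop)

lemma measurableSet_discordant :
    MeasurableSet {w : (ℝ × ℝ) × (ℝ × ℝ) | (w.1.1 - w.2.1) * (w.1.2 - w.2.2) < 0} :=
  measurableSet_lt (by fun_prop) (by fun_prop)

lemma measurableSet_lt_lt :
    MeasurableSet {w : (ℝ × ℝ) × (ℝ × ℝ) | w.1.1 < w.2.1 ∧ w.1.2 < w.2.2} :=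
  MeasurableSet.inter (s₁ := {w : (ℝ × ℝ) × (ℝ × ℝ) | w.1.1 < w.2.1})
    (s₂ := {w : (ℝ × ℝ) × (ℝ × ℝ) | w.1.2 < w.2.2})
    (measurableSet_lt (by fun_prop) (by fun_prop)) (measurableSet_lt (by fun_prop) (by fun_prop))

lemma measurableSet_lt_gt :
    MeasurableSet {w : (ℝ × ℝ) × (ℝ × ℝ) | w.1.1 < w.2.1 ∧ w.2.2 < w.1.2} :=
  MeasurableSet.inter (s₁ := {w : (ℝ × ℝ) × (ℝ × ℝ) | w.1.1 < w.2.1})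
    (s₂ := {w : (ℝ × ℝ) × (ℝ × ℝ) | w.2.2 < w.1.2})
    (measurableSet_lt (by fun_prop) (by fun_prop)) (measurableSet_lt (by fun_prop) (by fun_prop))

lemma concordant_add_discordant (hν : ν ≪ volume) :
    (ν.prod ν).real {w | 0 < (w.1.1 - w.2.1) * (w.1.2 - w.2.2)} +
      (ν.prod ν).real {w | (w.1.1 - w.2.1) * (w.1.2 - w.2.2) < 0} = 1 := by
  rw [← measureReal_union _ measurableSet_discordant]
  · have : (ν.prod ν).real (univ : Set ((ℝ × ℝ) × (ℝ × ℝ))) = 1 := by simp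
    rw [← this]
    refine measureReal_congr ?_
    rw [ae_eq_univ]
    refine measure_mono_null ?_ (ae_iff.1 (ae_no_ties ν hν))
    intro w hw
    simp only [mem_compl_iff, mem_union, mem_ofPred_eq, not_or, not_lt] at hw
    simp only [mem_ofPred_eq, ne_eq, not_not]
    exact le_antisymm hw.1 hw.2
  · rw [Set.disjoint_left]
    intro w h1 h2
    simp only [mem_ofPred_eq] at h1 h2
    exact lt_asymm h1 h2

lemma measureReal_swap {A : Set ((ℝ × ℝ) × (ℝ × ℝ))} (hA : MeasurableSet A) :
    (ν.prod ν).real (Prod.swap ⁻¹' A) = (ν.prod ν).real A := by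
  conv_rhs => rw [← Measure.prod_swap]
  rw [map_measureReal_apply measurable_swap hA]

/-- Concordance splits into two disjoint events exchanged by swapping the two points, and the
product law is invariant under the swap. -/
lemma concordant_eq :
    (ν.prod ν).real {w | 0 < (w.1.1 - w.2.1) * (w.1.2 - w.2.2)} =
      2 * (ν.prod ν).real {w | w.1.1 < w.2.1 ∧ w.1.2 < w.2.2} := by
  have h1 : {w : (ℝ × ℝ) × (ℝ × ℝ) | 0 < (w.1.1 - w.2.1) * (w.1.2 - w.2.2)} =
      {w | w.1.1 < w.2.1 ∧ w.1.2 < w.2.2} ∪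
        Prod.swap ⁻¹' {w | w.1.1 < w.2.1 ∧ w.1.2 < w.2.2} := by
    ext w
    simp only [mem_ofPred_eq, mem_union, mem_preimage, Prod.fst_swap, Prod.snd_swap, mul_pos_iff,
      sub_pos, sub_neg]
    tauto
  rw [h1, measureReal_union _ (measurable_swap measurableSet_lt_lt),
    measureReal_swap ν measurableSet_lt_lt]
  · ring
  · rw [Set.disjoint_left]
    intro w h1 h2
    simp only [mem_ofPred_eq, mem_preimage, Prod.fst_swap, Prod.snd_swap] at h1 h2
    exact lt_asymm h1.1 h2.1

lemma discordant_eq :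
    (ν.prod ν).real {w | (w.1.1 - w.2.1) * (w.1.2 - w.2.2) < 0} =
      2 * (ν.prod ν).real {w | w.1.1 < w.2.1 ∧ w.2.2 < w.1.2} := by
  have h1 : {w : (ℝ × ℝ) × (ℝ × ℝ) | (w.1.1 - w.2.1) * (w.1.2 - w.2.2) < 0} =
      {w | w.1.1 < w.2.1 ∧ w.2.2 < w.1.2} ∪
        Prod.swap ⁻¹' {w | w.1.1 < w.2.1 ∧ w.2.2 < w.1.2} := by
    ext w
    simp only [mem_ofPred_eq, mem_union, mem_preimage, Prod.fst_swap, Prod.snd_swap, mul_neg_iff,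
      sub_pos, sub_neg]
    tauto
  rw [h1, measureReal_union _ (measurable_swap measurableSet_lt_gt),
    measureReal_swap ν measurableSet_lt_gt]
  · ring
  · rw [Set.disjoint_left]
    intro w h1 h2
    simp only [mem_ofPred_eq, mem_preimage, Prod.fst_swap, Prod.snd_swap] at h1 h2
    exact lt_asymm h1.1 h2.1

lemma measurable_gStar (k : Fin 3) :
    Measurable fun w : (ℝ × ℝ) × (ℝ × ℝ) => gStar k w.1 w.2 := by
  fin_cases k
  · exact ((Measurable.ite measurableSet_lt_lt measurable_const measurable_const).const_mul
      4).sub_const 1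
  · exact (Measurable.ite measurableSet_concordant measurable_const measurable_const).sub
      (Measurable.ite measurableSet_discordant measurable_const measurable_const)
  · exact ((Measurable.ite measurableSet_lt_gt measurable_const measurable_const).const_mul
      4).const_sub 1

lemma abs_gStar_le (k : Fin 3) (x y : ℝ × ℝ) : |gStar k x y| ≤ 3 := by
  fin_cases k <;> simp only [gStar] <;> split_ifs <;> norm_num

lemma integral_ite_one {E : Type*} [MeasurableSpace E] {μ : Measure E} {P : E → Prop}
    [DecidablePred P] (hP : MeasurableSet {w | P w}) :
    ∫ w, (if P w then (1 : ℝ) else 0) ∂μ = μ.real {w | P w} := by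
  rw [← integral_indicator_one hP]
  refine integral_congr_ae (Filter.Eventually.of_forall fun w => ?_)
  simp [Set.indicator_apply]

lemma integrable_ite_one {E : Type*} [MeasurableSpace E] {μ : Measure E} [IsFiniteMeasure μ]
    {P : E → Prop} [DecidablePred P] (hP : MeasurableSet {w | P w}) :
    Integrable (fun w => if P w then (1 : ℝ) else 0) μ := by
  refine Integrable.of_bound
    (Measurable.ite hP measurable_const measurable_const).aestronglyMeasurable 1
    (Filter.Eventually.of_forall fun w => ?_)
  split_ifs <;> simp

/-- For `g₁` and `g₃` the means are `2 C - 1` and `1 - 2 D`, with `C`, `D` the concordance and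
discordance probabilities; both equal `C - D` because `C + D = 1`. -/
lemma integral_gStar (hν : ν ≪ volume) (k : Fin 3) :
    ∫ w, gStar k w.1 w.2 ∂(ν.prod ν) =
      (ν.prod ν).real {w | 0 < (w.1.1 - w.2.1) * (w.1.2 - w.2.2)} -
        (ν.prod ν).real {w | (w.1.1 - w.2.1) * (w.1.2 - w.2.2) < 0} := by
  have h1 := concordant_add_discordant ν hν
  have h2 := concordant_eq ν
  have h3 := discordant_eq ν
  fin_cases k
  · change ∫ w : (ℝ × ℝ) × (ℝ × ℝ),
      (4 * (if w.1.1 < w.2.1 ∧ w.1.2 < w.2.2 then (1 : ℝ) else 0) - 1) ∂(ν.prod ν) = _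
    rw [integral_sub ((integrable_ite_one measurableSet_lt_lt).const_mul 4) (integrable_const _),
      integral_const_mul, integral_ite_one measurableSet_lt_lt]
    simp only [integral_const, probReal_univ, smul_eq_mul, mul_one]
    linarith
  · change ∫ w : (ℝ × ℝ) × (ℝ × ℝ),
      ((if 0 < (w.1.1 - w.2.1) * (w.1.2 - w.2.2) then (1 : ℝ) else 0) -
        (if (w.1.1 - w.2.1) * (w.1.2 - w.2.2) < 0 then 1 else 0)) ∂(ν.prod ν) = _
    rw [integral_sub (integrable_ite_one measurableSet_concordant)
      (integrable_ite_one measurableSet_discordant),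
      integral_ite_one measurableSet_concordant, integral_ite_one measurableSet_discordant]
  · change ∫ w : (ℝ × ℝ) × (ℝ × ℝ),
      (1 - 4 * (if w.1.1 < w.2.1 ∧ w.2.2 < w.1.2 then (1 : ℝ) else 0)) ∂(ν.prod ν) = _
    rw [integral_sub (integrable_const _) ((integrable_ite_one measurableSet_lt_gt).const_mul 4),
      integral_const_mul, integral_ite_one measurableSet_lt_gt]
    simp only [integral_const, probReal_univ, smul_eq_mul, mul_one]
    linarith

end

/-! ### Integration against densities and the conditional law -/

lemma integral_withDensity_ofReal {E : Type*} [MeasurableSpace E] {μ : Measure E} {φ : E → ℝ}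
    (hφ : Measurable φ) (hφ0 : ∀ x, 0 ≤ φ x) (G : E → ℝ) :
    ∫ x, G x ∂(μ.withDensity fun x => ENNReal.ofReal (φ x)) = ∫ x, φ x * G x ∂μ := by
  rw [integral_withDensity_eq_integral_toReal_smul hφ.ennreal_ofReal
    (Filter.Eventually.of_forall fun _ => ENNReal.ofReal_lt_top)]
  simp only [ENNReal.toReal_ofReal (hφ0 _), smul_eq_mul]

lemma integral_prod_withDensity_ofReal {E : Type*} [MeasurableSpace E] {μ : Measure E}
    [SigmaFinite μ] {φ : E → ℝ}
    (hφ : Measurable φ) (hφ0 : ∀ x, 0 ≤ φ x) (G : E × E → ℝ) :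
    ∫ w, G w ∂((μ.withDensity fun x => ENNReal.ofReal (φ x)).prod
        (μ.withDensity fun x => ENNReal.ofReal (φ x))) =
      ∫ w, φ w.1 * φ w.2 * G w ∂(μ.prod μ) := by
  rw [prod_withDensity hφ.ennreal_ofReal hφ.ennreal_ofReal]
  rw [← integral_withDensity_ofReal (μ := μ.prod μ) (φ := fun w : E × E => φ w.1 * φ w.2)
    ((hφ.comp measurable_fst).mul (hφ.comp measurable_snd))
    (fun w => mul_nonneg (hφ0 _) (hφ0 _))]
  simp only [ENNReal.ofReal_mul (hφ0 _)]

section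
variable {p : ℕ} {f : ℝ × ℝ → (Fin p → ℝ) → ℝ} {z : Fin p → ℝ}

/-- The Bochner integral of a non-integrable function is `0`, so positivity of the marginal already
yields integrability. -/
lemma integrable_of_marginalDensity_pos (hz : 0 < marginalDensity f z) :
    Integrable fun x => f x z := by
  by_contra h
  rw [marginalDensity, integral_undef h] at hz
  exact lt_irrefl _ hz

lemma isProbabilityMeasure_conditionalLaw (h0 : ∀ x z, 0 ≤ f x z)
    (hz : 0 < marginalDensity f z) : IsProbabilityMeasure (conditionalLaw f z) := by
  refine ⟨?_⟩
  rw [conditionalLaw, withDensity_apply _ MeasurableSet.univ, Measure.restrict_univ,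
    ← ofReal_integral_eq_lintegral_ofReal
      ((integrable_of_marginalDensity_pos hz).div_const _)
      (Filter.Eventually.of_forall fun x => div_nonneg (h0 x z) hz.le), integral_div]
  change ENNReal.ofReal (marginalDensity f z / marginalDensity f z) = 1
  rw [div_self hz.ne', ENNReal.ofReal_one]

lemma abs_conditionalKendallTau_le (h0 : ∀ x z, 0 ≤ f x z)
    (hz : 0 < marginalDensity f z) : |conditionalKendallTau f z| ≤ 1 := by
  have := isProbabilityMeasure_conditionalLaw h0 hz
  unfold conditionalKendallTau
  rw [abs_le]
  have h1 : ∀ A : Set ((ℝ × ℝ) × (ℝ × ℝ)),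
    ((conditionalLaw f z).prod (conditionalLaw f z)).real A ≤ 1 := fun A => measureReal_le_one
  constructor
  · linarith [h1 {w | (w.1.1 - w.2.1) * (w.1.2 - w.2.2) < 0}, measureReal_nonneg
      (μ := (conditionalLaw f z).prod (conditionalLaw f z))
      (s := {w | 0 < (w.1.1 - w.2.1) * (w.1.2 - w.2.2)})]
  · linarith [h1 {w | 0 < (w.1.1 - w.2.1) * (w.1.2 - w.2.2)}, measureReal_nonneg
      (μ := (conditionalLaw f z).prod (conditionalLaw f z))
      (s := {w | (w.1.1 - w.2.1) * (w.1.2 - w.2.2) < 0})]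

/-- `gStar` has conditional mean `τ(z)`. -/
lemma integral_density_mul_gStar_sub (hm : Measurable fun x => f x z) (h0 : ∀ x z, 0 ≤ f x z)
    (hz : 0 < marginalDensity f z) (k : Fin 3) :
    ∫ w : (ℝ × ℝ) × (ℝ × ℝ), f w.1 z * f w.2 z * (gStar k w.1 w.2 - conditionalKendallTau f z)
      = 0 := by
  have hprob := isProbabilityMeasure_conditionalLaw h0 hz
  have h1 := integral_gStar (conditionalLaw f z) (withDensity_absolutelyContinuous _ _) k
  have hi : Integrable (fun w : (ℝ × ℝ) × (ℝ × ℝ) => gStar k w.1 w.2)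
      ((conditionalLaw f z).prod (conditionalLaw f z)) :=
    Integrable.of_bound (measurable_gStar k).aestronglyMeasurable 3
      (Filter.Eventually.of_forall fun w => abs_gStar_le k _ _)
  have h2 : ∫ w, (gStar k w.1 w.2 - conditionalKendallTau f z)
      ∂((conditionalLaw f z).prod (conditionalLaw f z)) = 0 := by
    rw [integral_sub hi (integrable_const _), h1]
    simp [conditionalKendallTau]
  unfold conditionalLaw at h2
  rw [integral_prod_withDensity_ofReal (φ := fun x => f x z / marginalDensity f z)
    (hm.div_const _) (fun x => div_nonneg (h0 x z) hz.le)] at h2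
  have h3 : ∫ w : (ℝ × ℝ) × (ℝ × ℝ),
      f w.1 z * f w.2 z * (gStar k w.1 w.2 - conditionalKendallTau f z) =
      marginalDensity f z ^ 2 * ∫ w : (ℝ × ℝ) × (ℝ × ℝ), (f w.1 z / marginalDensity f z) *
        (f w.2 z / marginalDensity f z) * (gStar k w.1 w.2 - conditionalKendallTau f z)
        ∂(volume.prod volume) := by
    rw [← integral_const_mul]
    refine integral_congr_ae (Filter.Eventually.of_forall fun w => ?_)
    simp only
    field_simp
  rw [h3, h2, mul_zero]

/-! ### Changes of variables and expectations of kernel terms -/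

lemma integral_scaledKernel_mul (K F : (Fin p → ℝ) → ℝ) (z : Fin p → ℝ) {h : ℝ} (hh : 0 < h) :
    ∫ y, scaledKernel K h (y - z) * F y = ∫ u, K u * F (z + h • u) := by
  have h1 := Measure.integral_comp_smul (volume : Measure (Fin p → ℝ))
    (fun y => K (h⁻¹ • y) * F (z + y)) h
  have h2 := integral_add_left_eq_self (μ := (volume : Measure (Fin p → ℝ)))
    (fun y => K (h⁻¹ • (y - z)) * F y) z
  simp only [add_sub_cancel_left] at h2
  simp only [smul_smul, inv_mul_cancel₀ hh.ne', one_smul] at h1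
  rw [h1, h2, Module.finrank_fin_fun, abs_of_pos (by positivity), smul_eq_mul,
    ← integral_const_mul]
  refine integral_congr_ae (Filter.Eventually.of_forall fun y => ?_)
  simp only [scaledKernel]
  ring

lemma integrable_scaledKernel_mul_iff (K F : (Fin p → ℝ) → ℝ) (z : Fin p → ℝ) {h : ℝ}
    (hh : 0 < h) :
    Integrable (fun y => scaledKernel K h (y - z) * F y) ↔
      Integrable fun u => K u * F (z + h • u) := by
  have h1 := integrable_comp_smul_iff (volume : Measure (Fin p → ℝ))
    (fun y => K (h⁻¹ • y) * F (z + y)) hh.ne'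
  simp only [smul_smul, inv_mul_cancel₀ hh.ne', one_smul] at h1
  rw [h1]
  have h2 := (measurePreserving_add_left (volume : Measure (Fin p → ℝ)) z).integrable_comp_emb
    (measurableEmbedding_addLeft z) (g := fun y => K (h⁻¹ • (y - z)) * F y)
  simp only [Function.comp_def, add_sub_cancel_left] at h2
  rw [h2]
  have h3 : (fun y => scaledKernel K h (y - z) * F y) =
      fun y => (h ^ p)⁻¹ * (K (h⁻¹ • (y - z)) * F y) := by
    funext y; simp only [scaledKernel]; ring
  rw [h3, integrable_const_mul_iff]
  exact IsUnit.mk0 _ (by positivity)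

end

/-- Fubini's theorem for the integral of `k(w₁) k(w₂) G`, where `G` depends only on first
components. -/
lemma integral_prod_kernel {A B : Type*} [MeasurableSpace A] [MeasurableSpace B] {μ : Measure A}
    {ν : Measure B} [SFinite μ] [SFinite ν] {k : A × B → ℝ} (hkm : Measurable k)
    (hk : Integrable k (μ.prod ν)) {G : A × A → ℝ} (hG : Measurable G) {C : ℝ}
    (hC : ∀ w, |G w| ≤ C) :
    ∫ w : (A × B) × (A × B), k w.1 * k w.2 * G (w.1.1, w.2.1) ∂((μ.prod ν).prod (μ.prod ν)) =
      ∫ x : A × A, (∫ z, k (x.1, z) ∂ν) * (∫ z, k (x.2, z) ∂ν) * G x ∂(μ.prod μ) := by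
  set m : A → ℝ := fun x => ∫ z, k (x, z) ∂ν with hm
  have hmm : Measurable m := hkm.stronglyMeasurable.integral_prod_right'.measurable
  have hmi : Integrable m μ := hk.integral_prod_left
  have hint1 : Integrable (fun w : (A × B) × (A × B) => k w.1 * k w.2 * G (w.1.1, w.2.1))
      ((μ.prod ν).prod (μ.prod ν)) :=
    (hk.mul_prod hk).mul_bdd (c := C) (hG.comp
      ((measurable_fst.comp measurable_fst).prodMk
        (measurable_fst.comp measurable_snd))).aestronglyMeasurable
      (Filter.Eventually.of_forall fun w => hC _)
  have hint2 : Integrable (fun x : A × A => m x.1 * m x.2 * G x) (μ.prod μ) :=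
    (hmi.mul_prod hmi).mul_bdd (c := C) hG.aestronglyMeasurable (Filter.Eventually.of_forall fun w => hC _)
  -- Fubini in one variable against a bounded test function. It is used for the inner integral, then
  -- for the outer one with the bounded function `x ↦ ∫ m y G (x, y)`.
  have hstep : ∀ (g : A → ℝ), Measurable g → (∀ D, (∀ x, |g x| ≤ D) →
      ∫ w, k w * g w.1 ∂(μ.prod ν) = ∫ x, m x * g x ∂μ) := by
    intro g hg D hD
    have hi : Integrable (fun w : A × B => k w * g w.1) (μ.prod ν) :=
      hk.mul_bdd (c := D) (hg.comp measurable_fst).aestronglyMeasurable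
        (Filter.Eventually.of_forall fun w => hD _)
    rw [integral_prod _ hi]
    refine integral_congr_ae (Filter.Eventually.of_forall fun x => ?_)
    simp only [hm]
    rw [integral_mul_const]
  rw [integral_prod _ hint1, integral_prod _ hint2]
  have h1 : ∀ w : A × B, ∫ w', k w * k w' * G (w.1, w'.1) ∂(μ.prod ν) =
      k w * ∫ x, m x * G (w.1, x) ∂μ := by
    intro w
    rw [← hstep (fun x => G (w.1, x)) (hG.comp (by fun_prop)) C fun x => hC _,
      ← integral_const_mul]
    simp only [mul_assoc]
  simp_rw [h1]
  have h2 : ∀ x, ∫ y, m x * m y * G (x, y) ∂μ = m x * ∫ y, m y * G (x, y) ∂μ := by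
    intro x
    rw [← integral_const_mul]
    simp only [mul_assoc]
  simp_rw [h2]
  refine hstep (fun x => ∫ y, m y * G (x, y) ∂μ) ?_ (∫ y, |m y| * C ∂μ) fun x => ?_
  · have : StronglyMeasurable fun q : A × A => m q.2 * G (q.1, q.2) :=
      ((hmm.comp measurable_snd).mul (hG.comp (by fun_prop))).stronglyMeasurable
    exact this.integral_prod_right'.measurable
  · refine (abs_integral_le_integral_abs).trans (integral_mono_of_nonneg
      (Filter.Eventually.of_forall fun y => abs_nonneg _) (hmi.abs.mul_const C)
      (Filter.Eventually.of_forall fun y => ?_))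
    simp only [abs_mul]
    exact mul_le_mul_of_nonneg_left (hC _) (abs_nonneg _)

section
variable {p : ℕ} {f : ℝ × ℝ → (Fin p → ℝ) → ℝ}

/-- The law with density `f` on `ℝ² × ℝᵖ`. -/
noncomputable def jointLaw (f : ℝ × ℝ → (Fin p → ℝ) → ℝ) :
    Measure ((ℝ × ℝ) × (Fin p → ℝ)) :=
  volume.withDensity fun w => ENNReal.ofReal (f w.1 w.2)

lemma integrable_density (hf : Measurable fun w : (ℝ × ℝ) × (Fin p → ℝ) => f w.1 w.2)
    (h0 : ∀ x z, 0 ≤ f x z) [IsFiniteMeasure (jointLaw f)] :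
    Integrable fun w : (ℝ × ℝ) × (Fin p → ℝ) => f w.1 w.2 := by
  refine ⟨hf.aestronglyMeasurable, ?_⟩
  rw [hasFiniteIntegral_iff_ofReal (Filter.Eventually.of_forall fun w => h0 _ _)]
  have := measure_lt_top (jointLaw f) univ
  rwa [jointLaw, withDensity_apply _ MeasurableSet.univ, Measure.restrict_univ] at this

lemma integral_jointLaw_snd (hf : Measurable fun w : (ℝ × ℝ) × (Fin p → ℝ) => f w.1 w.2)
    (h0 : ∀ x z, 0 ≤ f x z) [IsFiniteMeasure (jointLaw f)] {φ : (Fin p → ℝ) → ℝ}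
    (hφ : Measurable φ) {C : ℝ} (hC : ∀ z, |φ z| ≤ C) :
    ∫ w, φ w.2 ∂(jointLaw f) = ∫ z, φ z * marginalDensity f z := by
  rw [jointLaw, integral_withDensity_ofReal (φ := fun w : (ℝ × ℝ) × (Fin p → ℝ) => f w.1 w.2) hf
    (fun w => h0 _ _)]
  have hi : Integrable (fun w : (ℝ × ℝ) × (Fin p → ℝ) => f w.1 w.2 * φ w.2)
      (volume.prod volume) :=
    (integrable_density hf h0).mul_bdd (c := C) (hφ.comp measurable_snd).aestronglyMeasurable
      (Filter.Eventually.of_forall fun w => hC _)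
  rw [Measure.volume_eq_prod, integral_prod_symm _ hi]
  refine integral_congr_ae (Filter.Eventually.of_forall fun z => ?_)
  simp only [marginalDensity]
  rw [integral_mul_const, mul_comm]

/-! ### Bias and second moments of kernel terms under the joint law -/

section kernel
variable {K : (Fin p → ℝ) → ℝ} {α : ℕ} {h : ℝ}

lemma abs_le_kernelSup (hK : IsKernelOfOrder K α) (u : Fin p → ℝ) : |K u| ≤ kernelSup K := by
  obtain ⟨C, hC⟩ := hK.bounded
  exact le_ciSup (f := fun u => |K u|) ⟨C, by rintro _ ⟨u, rfl⟩; exact hC u⟩ u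

lemma kernelSup_pos (hK : IsKernelOfOrder K α) : 0 < kernelSup K := by
  by_contra hneg
  have h0 : ∀ u, K u = 0 := fun u => abs_nonpos_iff.1 ((abs_le_kernelSup hK u).trans (not_lt.1 hneg))
  have := hK.integral_eq_one
  simp [h0] at this

lemma integrable_kernel_sq (hK : IsKernelOfOrder K α) : Integrable fun u => K u ^ 2 := by
  have := hK.integrable.mul_bdd (c := kernelSup K) hK.measurable.aestronglyMeasurable
    (Filter.Eventually.of_forall fun u => abs_le_kernelSup hK u)
  simpa only [sq] using this

lemma integral_kernel_sq_pos (hK : IsKernelOfOrder K α) : 0 < ∫ u, K u ^ 2 := by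
  refine (integral_nonneg fun u => sq_nonneg _).lt_of_ne' fun h => ?_
  rw [integral_eq_zero_iff_of_nonneg (fun u => sq_nonneg _) (integrable_kernel_sq hK)] at h
  have h1 : ∫ u, K u = ∫ _u : Fin p → ℝ, (0 : ℝ) := integral_congr_ae (by
    filter_upwards [h] with u hu
    exact pow_eq_zero_iff (two_ne_zero) |>.1 hu)
  rw [hK.integral_eq_one, integral_zero] at h1
  exact one_ne_zero h1

lemma measurable_scaledKernel (hK : IsKernelOfOrder K α) (h : ℝ) :
    Measurable (scaledKernel K h) :=
  (hK.measurable.comp (measurable_const_smul _)).const_mul _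

lemma abs_scaledKernel_le (hK : IsKernelOfOrder K α) (hh : 0 < h) (u : Fin p → ℝ) :
    |scaledKernel K h u| ≤ kernelSup K / h ^ p := by
  rw [scaledKernel, abs_mul, abs_of_pos (by positivity), div_eq_inv_mul]
  exact mul_le_mul_of_nonneg_left (abs_le_kernelSup hK _) (by positivity)

lemma integral_jointLaw_scaledKernel (hK : IsKernelOfOrder K α) (hh : 0 < h)
    (hf : Measurable fun w : (ℝ × ℝ) × (Fin p → ℝ) => f w.1 w.2)
    (h0 : ∀ x z, 0 ≤ f x z) [IsFiniteMeasure (jointLaw f)] (z : Fin p → ℝ) :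
    ∫ w, scaledKernel K h (w.2 - z) ∂(jointLaw f) =
      ∫ u, K u * marginalDensity f (z + h • u) := by
  rw [integral_jointLaw_snd hf h0 (φ := fun y => scaledKernel K h (y - z))
    ((measurable_scaledKernel hK h).comp (measurable_id.sub_const z))
    fun y => abs_scaledKernel_le hK hh _, integral_scaledKernel_mul K _ z hh]

lemma marginalDensity_nonneg (h0 : ∀ x z, 0 ≤ f x z) (z : Fin p → ℝ) :
    0 ≤ marginalDensity f z :=
  integral_nonneg fun x => h0 x z

/-- Bias of the kernel density estimator. -/
lemma abs_integral_scaledKernel_sub_le (hK : IsKernelOfOrder K α) (hh : 0 < h) (hh1 : h ≤ 1)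
    (hf : Measurable fun w : (ℝ × ℝ) × (Fin p → ℝ) => f w.1 w.2)
    (h0 : ∀ x z, 0 ≤ f x z) [IsFiniteMeasure (jointLaw f)] {𝒵 : Set (Fin p → ℝ)} {C fmax : ℝ}
    (hfZ : MarginalSmoothness K α (marginalDensity f) 𝒵 C)
    (hfmax : ∀ z, marginalDensity f z ≤ fmax) {z : Fin p → ℝ} (hz : z ∈ 𝒵) :
    |(∫ w, scaledKernel K h (w.2 - z) ∂(jointLaw f)) - marginalDensity f z| ≤
      h ^ α / (α.factorial : ℝ) * C := by
  rw [integral_jointLaw_scaledKernel hK hh hf h0]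
  have hF : TimesDifferentiable α (marginalDensity f) := fun k hk =>
    hfZ.contDiff.differentiable_iteratedFDeriv (by exact_mod_cast hk)
  have hint : Integrable fun u => K u * marginalDensity f (z + h • u) := by
    refine hK.integrable.mul_bdd (c := fmax) ?_ (Filter.Eventually.of_forall fun u => ?_)
    · exact (hfZ.contDiff.continuous.comp (by fun_prop)).aestronglyMeasurable
    · rw [Real.norm_eq_abs, abs_of_nonneg (marginalDensity_nonneg h0 _)]
      exact hfmax _
  have h1 := (kernel_bias_single hK hF z hh hh1 hint).trans
    (mul_le_mul_right (hfZ.bound z hz) _)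
  have hC := hfZ.const_pos
  rw [← ENNReal.ofReal_mul (by positivity)] at h1
  exact (ENNReal.ofReal_le_ofReal_iff (by positivity)).1 h1

/-- The square of `K_h` is `h⁻ᵖ` times the rescaling of `K ^ 2`, so exactly one factor `h⁻ᵖ`
survives the substitution. -/
lemma integral_scaledKernel_sq_le (hK : IsKernelOfOrder K α) (hh : 0 < h)
    (hf : Measurable fun w : (ℝ × ℝ) × (Fin p → ℝ) => f w.1 w.2)
    (h0 : ∀ x z, 0 ≤ f x z) [IsFiniteMeasure (jointLaw f)] {fmax : ℝ}
    (hfmax : ∀ z, marginalDensity f z ≤ fmax) (z : Fin p → ℝ) :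
    ∫ w, scaledKernel K h (w.2 - z) ^ 2 ∂(jointLaw f) ≤ fmax * (∫ u, K u ^ 2) / h ^ p := by
  have hsq : ∀ u, scaledKernel K h u ^ 2 = (h ^ p)⁻¹ * scaledKernel (fun u => K u ^ 2) h u := by
    intro u; simp only [scaledKernel]; ring
  rw [integral_jointLaw_snd hf h0 (φ := fun y => scaledKernel K h (y - z) ^ 2)
    (((measurable_scaledKernel hK h).comp (measurable_id.sub_const z)).pow_const 2)
    (C := (kernelSup K / h ^ p) ^ 2) (fun y => by
      rw [abs_pow]; exact pow_le_pow_left₀ (abs_nonneg _) (abs_scaledKernel_le hK hh _) 2)]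
  simp_rw [hsq, mul_assoc]
  rw [integral_const_mul, integral_scaledKernel_mul (fun u => K u ^ 2) _ z hh, div_eq_inv_mul]
  refine mul_le_mul_of_nonneg_left ?_ (by positivity)
  rw [← integral_const_mul]
  refine integral_mono_of_nonneg
    (Filter.Eventually.of_forall fun u => mul_nonneg (sq_nonneg _) (marginalDensity_nonneg h0 _))
    ((integrable_kernel_sq hK).const_mul _) (Filter.Eventually.of_forall fun u => ?_)
  simp only
  rw [mul_comm]
  exact mul_le_mul_of_nonneg_right (hfmax _) (sq_nonneg _)

/-- The summand of the numerator of `τ̂(z) - τ(z)`. -/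
noncomputable def kendallSummand (f : ℝ × ℝ → (Fin p → ℝ) → ℝ) (K : (Fin p → ℝ) → ℝ) (h : ℝ)
    (k₀ : Fin 3) (z : Fin p → ℝ)
    (w : ((ℝ × ℝ) × (Fin p → ℝ)) × ((ℝ × ℝ) × (Fin p → ℝ))) : ℝ :=
  scaledKernel K h (w.1.2 - z) * scaledKernel K h (w.2.2 - z) *
    (gStar k₀ w.1.1 w.2.1 - conditionalKendallTau f z)

lemma abs_gStar_sub_tau_le (h0 : ∀ x z, 0 ≤ f x z) {z : Fin p → ℝ}
    (hz : 0 < marginalDensity f z) (k₀ : Fin 3) (x y : ℝ × ℝ) :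
    |gStar k₀ x y - conditionalKendallTau f z| ≤ 4 := by
  have h1 := abs_gStar_le k₀ x y
  have h2 := abs_conditionalKendallTau_le h0 hz
  have := abs_sub (gStar k₀ x y) (conditionalKendallTau f z)
  linarith

lemma measurable_kendallSummand (hK : IsKernelOfOrder K α) (k₀ : Fin 3) (z : Fin p → ℝ) :
    Measurable (kendallSummand f K h k₀ z) := by
  have h1 := measurable_scaledKernel hK h
  have h2 := measurable_gStar k₀
  unfold kendallSummand
  refine ((h1.comp (by fun_prop)).mul (h1.comp (by fun_prop))).mul (Measurable.sub_const ?_ _)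
  exact h2.comp ((measurable_fst.comp measurable_fst).prodMk (measurable_fst.comp measurable_snd))

lemma abs_kendallSummand_le (hK : IsKernelOfOrder K α) (hh : 0 < h) (h0 : ∀ x z, 0 ≤ f x z)
    {z : Fin p → ℝ} (hz : 0 < marginalDensity f z) (k₀ : Fin 3)
    (w : ((ℝ × ℝ) × (Fin p → ℝ)) × ((ℝ × ℝ) × (Fin p → ℝ))) :
    |kendallSummand f K h k₀ z w| ≤ 4 * (kernelSup K / h ^ p) ^ 2 := by
  have hCK := kernelSup_pos hK
  unfold kendallSummand
  rw [abs_mul, abs_mul]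
  calc _ ≤ (kernelSup K / h ^ p) * (kernelSup K / h ^ p) * 4 := by
        gcongr
        · exact abs_scaledKernel_le hK hh _
        · exact abs_scaledKernel_le hK hh _
        · exact abs_gStar_sub_tau_le h0 hz _ _ _
    _ = _ := by ring

lemma integral_kendallSummand_sq_le (hK : IsKernelOfOrder K α) (hh : 0 < h)
    (hf : Measurable fun w : (ℝ × ℝ) × (Fin p → ℝ) => f w.1 w.2)
    (h0 : ∀ x z, 0 ≤ f x z) [IsProbabilityMeasure (jointLaw f)] {fmax : ℝ}
    (hfmax : ∀ z, marginalDensity f z ≤ fmax) {z : Fin p → ℝ} (hz : 0 < marginalDensity f z)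
    (k₀ : Fin 3) :
    ∫ w, kendallSummand f K h k₀ z w ^ 2 ∂((jointLaw f).prod (jointLaw f)) ≤
      16 * (fmax * (∫ u, K u ^ 2) / h ^ p) ^ 2 := by
  have hk2 : Integrable (fun w : (ℝ × ℝ) × (Fin p → ℝ) => scaledKernel K h (w.2 - z) ^ 2)
      (jointLaw f) := by
    refine Integrable.of_bound (((measurable_scaledKernel hK h).comp
      (measurable_snd.sub_const z)).pow_const 2).aestronglyMeasurable ((kernelSup K / h ^ p) ^ 2)
      (Filter.Eventually.of_forall fun w => ?_)
    rw [Real.norm_eq_abs, abs_pow]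
    exact pow_le_pow_left₀ (abs_nonneg _) (abs_scaledKernel_le hK hh _) 2
  calc _ ≤ ∫ w, 16 * (scaledKernel K h (w.1.2 - z) ^ 2 * scaledKernel K h (w.2.2 - z) ^ 2)
        ∂((jointLaw f).prod (jointLaw f)) := by
        refine integral_mono_of_nonneg (Filter.Eventually.of_forall fun w => sq_nonneg _)
          ((hk2.mul_prod hk2).const_mul 16) (Filter.Eventually.of_forall fun w => ?_)
        have h4 := abs_gStar_sub_tau_le h0 hz k₀ w.1.1 w.2.1
        have h16 : (gStar k₀ w.1.1 w.2.1 - conditionalKendallTau f z) ^ 2 ≤ 16 := by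
          rw [← sq_abs]; nlinarith [abs_nonneg (gStar k₀ w.1.1 w.2.1 - conditionalKendallTau f z)]
        simp only [kendallSummand]
        rw [mul_pow, mul_pow, mul_comm]
        exact mul_le_mul_of_nonneg_right h16 (by positivity)
    _ = 16 * ((∫ w, scaledKernel K h (w.2 - z) ^ 2 ∂(jointLaw f)) *
          ∫ w, scaledKernel K h (w.2 - z) ^ 2 ∂(jointLaw f)) := by
        rw [integral_const_mul]
        congr 1
        exact integral_prod_mul (fun w : (ℝ × ℝ) × (Fin p → ℝ) => scaledKernel K h (w.2 - z) ^ 2)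
          (fun w : (ℝ × ℝ) × (Fin p → ℝ) => scaledKernel K h (w.2 - z) ^ 2)
    _ ≤ _ := by
        have h1 := integral_scaledKernel_sq_le hK hh hf h0 hfmax z
        have h2 : 0 ≤ ∫ w, scaledKernel K h (w.2 - z) ^ 2 ∂(jointLaw f) :=
          integral_nonneg fun w => sq_nonneg _
        rw [← sq]
        gcongr

/-- Bias of the off-diagonal part of the numerator of `τ̂(z) - τ(z)`. -/
lemma abs_integral_kendallSummand_le (hK : IsKernelOfOrder K α) (hh : 0 < h) (hh1 : h ≤ 1)
    (hf : Measurable fun w : (ℝ × ℝ) × (Fin p → ℝ) => f w.1 w.2)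
    (h0 : ∀ x z, 0 ≤ f x z) [IsProbabilityMeasure (jointLaw f)] {𝒵 : Set (Fin p → ℝ)} {C : ℝ}
    (hfXZ : JointSmoothness K α f 𝒵 C) {z : Fin p → ℝ} (hz : z ∈ 𝒵)
    (hpos : 0 < marginalDensity f z) (k₀ : Fin 3) :
    |∫ w, kendallSummand f K h k₀ z w ∂((jointLaw f).prod (jointLaw f))| ≤
      4 * (h ^ α / (α.factorial : ℝ) * C) := by
  set G : (ℝ × ℝ) × (ℝ × ℝ) → ℝ := fun x => gStar k₀ x.1 x.2 - conditionalKendallTau f z with hG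
  have hGm : Measurable G := (measurable_gStar k₀).sub_const _
  have hG4 : ∀ x, |G x| ≤ 4 := fun x => abs_gStar_sub_tau_le h0 hpos k₀ _ _
  set k : (ℝ × ℝ) × (Fin p → ℝ) → ℝ := fun w => scaledKernel K h (w.2 - z) * f w.1 w.2 with hk
  have hKm : Measurable fun w : (ℝ × ℝ) × (Fin p → ℝ) => scaledKernel K h (w.2 - z) :=
    (measurable_scaledKernel hK h).comp (measurable_snd.sub_const z)
  have hkm : Measurable k := hKm.mul hf
  have hki : Integrable k (volume.prod volume) :=
    (integrable_density hf h0).bdd_mul (c := kernelSup K / h ^ p) hKm.aestronglyMeasurable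
      (Filter.Eventually.of_forall fun w => abs_scaledKernel_le hK hh _)
  set m : ℝ × ℝ → ℝ := fun x => ∫ u, K u * f x (z + h • u) with hm
  have hkz : ∀ x, ∫ y, k (x, y) = m x := fun x => integral_scaledKernel_mul K (f x) z hh
  have hmi : Integrable m := by
    simpa only [hkz] using hki.integral_prod_left
  have hfz : Integrable fun x => f x z := integrable_of_marginalDensity_pos hpos
  -- Integrating out the covariates replaces `f` by its smoothed version `m`. The subtracted term
  -- has integral zero because `g` has conditional mean `τ(z)`; it leaves a difference of products
  -- controlled by `kernel_bias_product`.
  have hE : ∫ w, kendallSummand f K h k₀ z w ∂((jointLaw f).prod (jointLaw f)) =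
      ∫ x : (ℝ × ℝ) × (ℝ × ℝ), (m x.1 * m x.2 - f x.1 z * f x.2 z) * G x := by
    unfold jointLaw
    rw [integral_prod_withDensity_ofReal
      (φ := fun w : (ℝ × ℝ) × (Fin p → ℝ) => f w.1 w.2) hf (fun w => h0 _ _)]
    have h1 := integral_prod_kernel hkm hki hGm hG4
    simp only [hkz] at h1
    have h2 := integral_density_mul_gStar_sub (f := f) (z := z)
      (hf.comp (measurable_id.prodMk measurable_const)) h0 hpos k₀
    have h3 : ∫ x : (ℝ × ℝ) × (ℝ × ℝ), (m x.1 * m x.2 - f x.1 z * f x.2 z) * G x =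
        (∫ x : (ℝ × ℝ) × (ℝ × ℝ), m x.1 * m x.2 * G x) -
          ∫ x : (ℝ × ℝ) × (ℝ × ℝ), f x.1 z * f x.2 z * G x := by
      simp_rw [sub_mul]
      rw [Measure.volume_eq_prod]
      exact integral_sub
        ((hmi.mul_prod hmi).mul_bdd (c := 4) hGm.aestronglyMeasurable
          (Filter.Eventually.of_forall hG4))
        ((hfz.mul_prod hfz).mul_bdd (c := 4) hGm.aestronglyMeasurable
          (Filter.Eventually.of_forall hG4))
    rw [h3, h2, sub_zero, Measure.volume_eq_prod (ℝ × ℝ) (ℝ × ℝ), ← h1]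
    refine integral_congr_ae (Filter.Eventually.of_forall fun w => ?_)
    simp only [kendallSummand, hk, hG]
    ring
  have hae : ∀ᵐ x : ℝ × ℝ, TimesDifferentiable α (f x) ∧
      Integrable fun u => K u * f x (z + h • u) := by
    filter_upwards [hfXZ.differentiable, hki.prod_right_ae] with x hx1 hx2
    exact ⟨hx1, (integrable_scaledKernel_mul_iff K (f x) z hh).1 hx2⟩
  have hae2 : ∀ᵐ x : (ℝ × ℝ) × (ℝ × ℝ),
      (TimesDifferentiable α (f x.1) ∧ Integrable fun u => K u * f x.1 (z + h • u)) ∧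
      (TimesDifferentiable α (f x.2) ∧ Integrable fun u => K u * f x.2 (z + h • u)) := by
    rw [Measure.volume_eq_prod]
    exact (Measure.quasiMeasurePreserving_fst.ae hae).and
      (Measure.quasiMeasurePreserving_snd.ae hae)
  set T : ((Fin p → ℝ) × (Fin p → ℝ)) × ((ℝ × ℝ) × (ℝ × ℝ)) → ENNReal := fun w =>
      ENNReal.ofReal (|K w.1.1| * |K w.1.2|) *
        ∑ k : Fin (α + 1), (α.choose k.1 : ENNReal) * ∑ idx : Fin α → Fin p,
          derivativeSup f k idx w.1.1 w.1.2 w.2.1 w.2.2 z *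
            ENNReal.ofReal
              |(∏ l, w.1.1 (headIdx idx k l)) * ∏ l, w.1.2 (tailIdx idx k l)| with hT
  have hTm : AEMeasurable T := by
    have hKm' := hK.measurable
    refine AEMeasurable.mul ?_ (Finset.aemeasurable_fun_sum _ fun k _ =>
      AEMeasurable.const_mul (Finset.aemeasurable_fun_sum _ fun idx _ =>
        (hfXZ.sup_aemeasurable z hz k idx).mul ?_) _)
    · refine (Measurable.ennreal_ofReal ?_).aemeasurable
      exact ((hKm'.comp (by fun_prop)).abs).mul ((hKm'.comp (by fun_prop)).abs)
    · refine (Measurable.ennreal_ofReal ?_).aemeasurable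
      exact ((Finset.measurable_fun_prod _ fun l _ => by fun_prop).mul
        (Finset.measurable_fun_prod _ fun l _ => by fun_prop)).abs
  -- Tonelli's theorem exchanges the order of integration; this is where measurability of the
  -- suprema enters.
  have hTle : ∫⁻ x : (ℝ × ℝ) × (ℝ × ℝ), ∫⁻ w : (Fin p → ℝ) × (Fin p → ℝ), T (w, x) ≤
      ENNReal.ofReal C := by
    have := hfXZ.bound z hz
    rw [Measure.volume_eq_prod, lintegral_prod_symm _ hTm] at this
    exact this
  have hCpos := hfXZ.const_pos
  have hfinal : ENNReal.ofReal
      |∫ w, kendallSummand f K h k₀ z w ∂((jointLaw f).prod (jointLaw f))| ≤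
      ENNReal.ofReal (4 * (h ^ α / (α.factorial : ℝ) * C)) := by
    rw [hE]
    refine (ofReal_abs_integral_le _).trans ?_
    calc _ ≤ ∫⁻ x : (ℝ × ℝ) × (ℝ × ℝ), ENNReal.ofReal (4 * (h ^ α / (α.factorial : ℝ))) *
          ∫⁻ w : (Fin p → ℝ) × (Fin p → ℝ), T (w, x) := by
          refine lintegral_mono_ae ?_
          filter_upwards [hae2] with x hx
          have h1 := kernel_bias_product hK hx.1.1 hx.2.1 z hh hh1 hx.1.2 hx.2.2
          rw [abs_mul, mul_comm |_| |G x|, ENNReal.ofReal_mul (abs_nonneg _),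
            ENNReal.ofReal_mul (by norm_num : (0 : ℝ) ≤ 4), mul_assoc]
          exact mul_le_mul' (ENNReal.ofReal_le_ofReal (hG4 x)) h1
      _ = ENNReal.ofReal (4 * (h ^ α / (α.factorial : ℝ))) *
          ∫⁻ x : (ℝ × ℝ) × (ℝ × ℝ), ∫⁻ w : (Fin p → ℝ) × (Fin p → ℝ), T (w, x) :=
          lintegral_const_mul' _ _ ENNReal.ofReal_ne_top
      _ ≤ ENNReal.ofReal (4 * (h ^ α / (α.factorial : ℝ))) * ENNReal.ofReal C := by gcongr
      _ = _ := by rw [← ENNReal.ofReal_mul (by positivity)]; ring_nf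
  exact (ENNReal.ofReal_le_ofReal_iff (by positivity)).1 hfinal

end kernel

end

/-! ### Concentration of the estimated conditional Kendall's tau -/

section
variable {p : ℕ} {f : ℝ × ℝ → (Fin p → ℝ) → ℝ} {K : (Fin p → ℝ) → ℝ} {α : ℕ} {h : ℝ}

/-- The weights sum to one, so `τ` can be moved inside the double sum; the diagonal is then split
off. -/
lemma kendallTauEstimator_sub_eq {n : ℕ} (k₀ : Fin 3) (X : Fin n → ℝ × ℝ)
    (Z : Fin n → Fin p → ℝ) (z : Fin p → ℝ) (hS : kernelSum K h Z z ≠ 0) :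
    kendallTauEstimator (gStar k₀) K h X Z z - conditionalKendallTau f z =
      (∑ q ∈ Finset.univ.offDiag, kendallSummand f K h k₀ z ((X q.1, Z q.1), (X q.2, Z q.2)) +
        ∑ i, kendallSummand f K h k₀ z ((X i, Z i), (X i, Z i))) / kernelSum K h Z z ^ 2 := by
  set S := kernelSum K h Z z with hSdef
  have h1 : ∑ q ∈ Finset.univ.offDiag,
      kendallSummand f K h k₀ z ((X q.1, Z q.1), (X q.2, Z q.2)) +
        ∑ i, kendallSummand f K h k₀ z ((X i, Z i), (X i, Z i)) =
      ∑ i, ∑ j, kendallSummand f K h k₀ z ((X i, Z i), (X j, Z j)) := by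
    rw [← Finset.sum_product', ← Finset.diag_union_offDiag, Finset.sum_union
      (Finset.disjoint_diag_offDiag _), Finset.sum_diag, add_comm]
  have h2 : ∑ i, ∑ j, scaledKernel K h (Z i - z) * scaledKernel K h (Z j - z) = S ^ 2 := by
    rw [← Finset.sum_mul_sum, sq]; rfl
  rw [h1, eq_div_iff (by positivity)]
  have h3 : kendallTauEstimator (gStar k₀) K h X Z z * S ^ 2 =
      ∑ i, ∑ j, scaledKernel K h (Z i - z) * scaledKernel K h (Z j - z) *
        gStar k₀ (X i) (X j) := by
    unfold kendallTauEstimator kernelWeight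
    rw [Finset.sum_mul]
    refine Finset.sum_congr rfl fun i _ => ?_
    rw [Finset.sum_mul]
    refine Finset.sum_congr rfl fun j _ => ?_
    rw [← hSdef]
    field_simp
  rw [sub_mul, h3, ← h2, Finset.mul_sum, ← Finset.sum_sub_distrib]
  refine Finset.sum_congr rfl fun i _ => ?_
  rw [Finset.mul_sum, ← Finset.sum_sub_distrib]
  refine Finset.sum_congr rfl fun j _ => ?_
  simp only [kendallSummand]
  ring

/-- There are at most `n ^ 2` off-diagonal terms and `n` diagonal ones, each of the latter bounded
by the sup norm; the denominator is at least `(n fmin / 2) ^ 2`. -/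
lemma abs_kendallTauEstimator_sub_le (hK : IsKernelOfOrder K α) (hh : 0 < h)
    (h0 : ∀ x z, 0 ≤ f x z) {n : ℕ} (hn : 2 ≤ n) (k₀ : Fin 3) (X : Fin n → ℝ × ℝ)
    (Z : Fin n → Fin p → ℝ) {z : Fin p → ℝ} {fmin u : ℝ} (hfmin : 0 < fmin)
    (hz : 0 < marginalDensity f z) (hS : n * (fmin / 2) ≤ kernelSum K h Z z)
    (hU : |(1 / ((n : ℝ) * (n - 1))) * ∑ q ∈ Finset.univ.offDiag,
      kendallSummand f K h k₀ z ((X q.1, Z q.1), (X q.2, Z q.2))| ≤ u) :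
    |kendallTauEstimator (gStar k₀) K h X Z z - conditionalKendallTau f z| ≤
      4 / fmin ^ 2 * (u + 4 * (kernelSup K / h ^ p) ^ 2 / n) := by
  have hn2 : (2 : ℝ) ≤ n := by exact_mod_cast hn
  have hn0 : (0 : ℝ) < n := by linarith
  have hn1 : (0 : ℝ) < n - 1 := by linarith
  have hSpos : 0 < kernelSum K h Z z := lt_of_lt_of_le (by positivity) hS
  rw [kendallTauEstimator_sub_eq (f := f) k₀ X Z z hSpos.ne']
  set V := ∑ q ∈ Finset.univ.offDiag, kendallSummand f K h k₀ z ((X q.1, Z q.1), (X q.2, Z q.2))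
  set B := (kernelSup K / h ^ p) ^ 2
  have hu : 0 ≤ u := (abs_nonneg _).trans hU
  have hV : |V| ≤ n ^ 2 * u := by
    rw [abs_mul, abs_of_pos (by positivity), one_div, inv_mul_le_iff₀ (by positivity)] at hU
    nlinarith
  have hdiag : |∑ i, kendallSummand f K h k₀ z ((X i, Z i), (X i, Z i))| ≤ n * (4 * B) := by
    refine (Finset.abs_sum_le_sum_abs _ _).trans ((Finset.sum_le_sum fun i _ =>
      abs_kendallSummand_le hK hh h0 hz k₀ _).trans (le_of_eq ?_))
    simp [B]
  rw [abs_div, abs_of_pos (by positivity : 0 < kernelSum K h Z z ^ 2),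
    div_le_iff₀ (by positivity)]
  have hB : 0 ≤ B := sq_nonneg _
  calc _ ≤ n ^ 2 * u + n * (4 * B) := (abs_add_le _ _).trans (add_le_add hV hdiag)
    _ = 4 / fmin ^ 2 * (u + 4 * B / n) * (n * (fmin / 2)) ^ 2 := by field_simp; ring
    _ ≤ _ := by gcongr

end

section
variable {Ω : Type*} [MeasurableSpace Ω] {μ : Measure Ω} [IsProbabilityMeasure μ] {p n : ℕ}
  {f : ℝ × ℝ → (Fin p → ℝ) → ℝ} {X : Fin n → Ω → ℝ × ℝ} {Z : Fin n → Ω → Fin p → ℝ}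
  {K : (Fin p → ℝ) → ℝ} {α : ℕ} {h : ℝ}

lemma IsSampleFrom.isProbabilityMeasure_jointLaw (hs : IsSampleFrom μ f X Z) (hn : 0 < n) :
    IsProbabilityMeasure (jointLaw f) := by
  rw [jointLaw, ← hs.law ⟨0, hn⟩]
  exact Measure.isProbabilityMeasure_map
    ((hs.measurable_X _).prodMk (hs.measurable_Z _)).aemeasurable

/-- Exponential bound for the kernel density estimator. -/
lemma measureReal_kernelSum_le (hs : IsSampleFrom μ f X Z) (hn : 0 < n)
    (hK : IsKernelOfOrder K α) (hh : 0 < h) {fmin fmax : ℝ} (hfmin : 0 < fmin) (hfmax0 : 0 < fmax)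
    (hfmax : ∀ z, marginalDensity f z ≤ fmax) (z : Fin p → ℝ) :
    μ.real {ω | fmin / 4 ≤ |(1 / (n : ℝ)) * kernelSum K h (fun j => Z j ω) z -
        ∫ w, scaledKernel K h (w.2 - z) ∂(jointLaw f)|} ≤
      2 * Real.exp (-((n : ℝ) * h ^ p * (fmin ^ 2 /
        (32 * fmax * (∫ u, K u ^ 2) + (8 / 3) * kernelSup K * fmin)))) := by
  have := hs.isProbabilityMeasure_jointLaw hn
  have hCK := kernelSup_pos hK
  have hI := integral_kernel_sq_pos hK
  set I := ∫ u, K u ^ 2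
  have hφ : Measurable fun w : (ℝ × ℝ) × (Fin p → ℝ) => scaledKernel K h (w.2 - z) :=
    (measurable_scaledKernel hK h).comp (measurable_snd.sub_const z)
  have hWm : ∀ i, Measurable fun ω => (X i ω, Z i ω) := fun i =>
    (hs.measurable_X i).prodMk (hs.measurable_Z i)
  have hmap : ∀ i (φ : (ℝ × ℝ) × (Fin p → ℝ) → ℝ), Measurable φ →
      ∫ ω, φ (X i ω, Z i ω) ∂μ = ∫ w, φ w ∂(jointLaw f) := by
    intro i φ hφ
    rw [jointLaw, ← hs.law i, integral_map (hWm i).aemeasurable hφ.aestronglyMeasurable]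
  have h1 := bernstein_average (μ := μ) (m := n) hn
    (ξ := fun i ω => scaledKernel K h (Z i ω - z)) (b := kernelSup K / h ^ p)
    (v := fmax * I / h ^ p) (e := ∫ w, scaledKernel K h (w.2 - z) ∂(jointLaw f)) (x := fmin / 4)
    (hs.indep.comp (fun _ w => scaledKernel K h (w.2 - z)) fun _ => hφ)
    (fun i => hφ.comp (hWm i)) (fun i ω => abs_scaledKernel_le hK hh _)
    (fun i => by
      rw [hmap i (fun w => scaledKernel K h (w.2 - z) ^ 2) (hφ.pow_const 2)]
      exact integral_scaledKernel_sq_le hK hh hs.density_measurable hs.density_nonneg hfmax z)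
    (fun i => hmap i (fun w => scaledKernel K h (w.2 - z)) hφ)
    (by positivity) (by positivity) (by positivity)
  refine h1.trans (le_of_eq ?_)
  congr 3
  have : (n : ℝ) * (fmin / 4) ^ 2 /
      (2 * (fmax * I / h ^ p) + 2 / 3 * (kernelSup K / h ^ p) * (fmin / 4)) =
      n * (fmin / 4) ^ 2 / ((2 * fmax * I + 1 / 6 * kernelSup K * fmin) / h ^ p) := by
    congr 1; ring
  rw [this]
  have h32 : 32 * fmax * I + 8 / 3 * kernelSup K * fmin =
      16 * (2 * fmax * I + 1 / 6 * kernelSup K * fmin) := by ring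
  rw [h32]
  field_simp
  ring

/-- Exponential bound for the off-diagonal part of the numerator of `τ̂(z) - τ(z)`. -/
lemma measureReal_kendallSummand_le (hs : IsSampleFrom μ f X Z) (hn : 2 ≤ n)
    (hK : IsKernelOfOrder K α) (hh : 0 < h) {fmax x : ℝ} (hfmax0 : 0 < fmax)
    (hfmax : ∀ z, marginalDensity f z ≤ fmax) {z : Fin p → ℝ} (hz : 0 < marginalDensity f z)
    (hx : 0 < x) (k₀ : Fin 3) :
    μ.real {ω | 4 * x ≤ |(1 / ((n : ℝ) * (n - 1))) * ∑ q ∈ Finset.univ.offDiag,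
        kendallSummand f K h k₀ z ((X q.1 ω, Z q.1 ω), (X q.2 ω, Z q.2 ω)) -
        ∫ w, kendallSummand f K h k₀ z w ∂((jointLaw f).prod (jointLaw f))|} ≤
      2 * Real.exp (-(((n : ℝ) - 1) * h ^ (2 * p) * x ^ 2 /
        (4 * (fmax * ∫ u, K u ^ 2) ^ 2 + 8 / 3 * kernelSup K ^ 2 * x))) := by
  have := hs.isProbabilityMeasure_jointLaw (by omega)
  have hCK := kernelSup_pos hK
  have hI := integral_kernel_sq_pos hK
  set V := fmax * ∫ u, K u ^ 2
  have hV : 0 < V := by positivity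
  set H := h ^ p with hH
  have hH0 : 0 < H := by positivity
  have h1 := bernstein_uStatistic (μ := μ) (n := n) (m := n / 2) (by omega) (by omega)
    (W := fun i ω => (X i ω, Z i ω)) hs.indep
    (fun i => (hs.measurable_X i).prodMk (hs.measurable_Z i)) (ν := jointLaw f) hs.law
    (F := kendallSummand f K h k₀ z) (b := 4 * (kernelSup K / H) ^ 2)
    (v := 16 * (V / H) ^ 2) (x := 4 * x)
    (measurable_kendallSummand hK k₀ z)
    (fun w => abs_kendallSummand_le hK hh hs.density_nonneg hz k₀ w)
    (integral_kendallSummand_sq_le hK hh hs.density_measurable hs.density_nonneg hfmax hz k₀)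
    (by positivity) (by positivity) (by positivity)
  refine h1.trans (mul_le_mul_of_nonneg_left (Real.exp_le_exp.2 (neg_le_neg ?_)) (by norm_num))
  -- Only `⌊n/2⌋` disjoint pairs are available, whence `n - 1` in place of `n`.
  have hm : ((n : ℝ) - 1) ≤ 2 * ((n / 2 : ℕ) : ℝ) := by
    have : n ≤ 2 * (n / 2) + 1 := by omega
    have : (n : ℝ) ≤ 2 * ((n / 2 : ℕ) : ℝ) + 1 := by exact_mod_cast this
    linarith
  have hpow : h ^ (2 * p) = H ^ 2 := by rw [hH, ← pow_mul, mul_comm]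
  rw [hpow]
  have e1 : ((n / 2 : ℕ) : ℝ) * (4 * x) ^ 2 /
      (2 * (16 * (V / H) ^ 2) + 2 / 3 * (4 * (kernelSup K / H) ^ 2) * (4 * x)) =
      2 * ((n / 2 : ℕ) : ℝ) * H ^ 2 * x ^ 2 / (4 * V ^ 2 + 4 / 3 * kernelSup K ^ 2 * x) := by
    have : 2 * (16 * (V / H) ^ 2) + 2 / 3 * (4 * (kernelSup K / H) ^ 2) * (4 * x) =
        8 * (4 * V ^ 2 + 4 / 3 * kernelSup K ^ 2 * x) / H ^ 2 := by
      field_simp; ring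
    rw [this]
    field_simp
    ring
  rw [e1]
  -- The sharper constant `4 / 3` is relaxed to `8 / 3`, the form matching `C₃`.
  gcongr
  norm_num

end

/-! ### Union bound, link function and the main theorem -/

lemma measureReal_iUnion_fin_le {Ω : Type*} [MeasurableSpace Ω] {μ : Measure Ω} [IsFiniteMeasure μ]
    {m : ℕ} (A : Fin m → Set Ω) {c : ℝ} (hA : ∀ i, μ.real (A i) ≤ c) :
    μ.real (⋃ i, A i) ≤ m * c := by
  refine (measureReal_iUnion_fintype_le A).trans ((Finset.sum_le_sum fun i _ => hA i).trans ?_)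
  simp

/-- A link function that is Lipschitz near `τ` transports an estimation error. -/
lemma abs_link_sub_le {Λ : ℝ → ℝ} {𝒪 : Set ℝ} (h𝒪 : IsOpen 𝒪) (hΛ : ContDiffOn ℝ 1 Λ 𝒪) {C ε : ℝ}
    (hΛ' : ∀ y ∈ 𝒪, |deriv Λ y| ≤ C) (hC : 0 ≤ C) {τ y : ℝ}
    (hnear : ∀ y, |y - τ| ≤ ε → y ∈ 𝒪) (hy : |y - τ| ≤ ε) : |Λ y - Λ τ| ≤ C * ε := by
  have hε : 0 ≤ ε := (abs_nonneg _).trans hy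
  have hmem : ∀ x ∈ Metric.closedBall τ ε, x ∈ 𝒪 := fun x hx => hnear x (by
    rwa [Metric.mem_closedBall, Real.dist_eq] at hx)
  have := Convex.norm_image_sub_le_of_norm_deriv_le (𝕜 := ℝ) (f := Λ) (C := C)
    (s := Metric.closedBall τ ε) (x := τ) (y := y)
    (fun x hx => (hΛ.contDiffAt (h𝒪.mem_nhds (hmem x hx))).differentiableAt (by norm_num))
    (fun x hx => hΛ' x (hmem x hx)) (convex_closedBall τ ε) (Metric.mem_closedBall_self hε)
    (by rwa [Metric.mem_closedBall, Real.dist_eq])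
  rw [Real.norm_eq_abs, Real.norm_eq_abs] at this
  exact this.trans (mul_le_mul_of_nonneg_left hy hC)

set_option maxHeartbeats 1000000 in
theorem mainTheorem1
    {Ω : Type*} [MeasurableSpace Ω] (μ : Measure Ω) [IsProbabilityMeasure μ]
    (p n n' p' : ℕ)
    -- the sample and its density, the compact set of covariate values
    (f : ℝ × ℝ → (Fin p → ℝ) → ℝ)
    (X : Fin n → Ω → ℝ × ℝ) (Z : Fin n → Ω → Fin p → ℝ)
    (hsample : IsSampleFrom μ f X Z)
    (𝒵 : Set (Fin p → ℝ)) (h𝒵 : IsCompact 𝒵)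
    -- kernel and smoothness assumptions
    (K : (Fin p → ℝ) → ℝ) (α : ℕ) (hK : IsKernelOfOrder K α)
    (CKα : ℝ) (hfZ : MarginalSmoothness K α (marginalDensity f) 𝒵 CKα)
    (fmin fmax : ℝ) (hfmin_pos : 0 < fmin)
    (hfmin : ∀ z ∈ 𝒵, fmin ≤ marginalDensity f z)
    (hfmax : ∀ z, marginalDensity f z ≤ fmax)
    (CXZα : ℝ) (hfXZ : JointSmoothness K α f 𝒵 CXZα)
    -- the model: link function, dictionary, sparse parameter
    (Λ : ℝ → ℝ) (ψ : (Fin p → ℝ) → Fin p' → ℝ) (βstar : Fin p' → ℝ)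
    (hmodel : ∀ z ∈ 𝒵, Λ (conditionalKendallTau f z) = ∑ j, ψ z j * βstar j)
    (s : ℕ) (hs1 : 1 ≤ s) (hsp : s ≤ p')
    (hsparse : (Finset.univ.filter fun j => βstar j ≠ 0).card ≤ s)
    (Cψ : ℝ) (hCψ : 0 < Cψ) (hψ : ∀ z ∈ 𝒵, ∀ j, |ψ z j| ≤ Cψ)
    (CΛ : ℝ) (hCΛ : 0 < CΛ)
    (𝒪 : Set ℝ) (h𝒪 : IsOpen 𝒪)
    (hΛ : ContDiffOn ℝ 1 Λ 𝒪) (hΛ' : ∀ y ∈ 𝒪, |deriv Λ y| ≤ CΛ)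
    -- the design
    (z' : Fin n' → Fin p → ℝ) (hz' : ∀ i, z' i ∈ 𝒵)
    (hRE : RestrictedEigenvalueCondition (designMatrix ψ z') s 3)
    -- tuning parameters
    (γ t h : ℝ) (hγ : 4 ≤ γ) (ht : 0 < t) (hh : 0 < h) (hh1 : h ≤ 1)
    (hnear : ∀ z ∈ 𝒵, ∀ y, |y - conditionalKendallTau f z| ≤ t / (Cψ * CΛ) → y ∈ 𝒪)
    (hbandwidth : h ^ α ≤ min (fmin * α.factorial / (4 * CKα))
      (fmin ^ 4 * α.factorial * t /
        (8 * Cψ * CΛ * (fmin ^ 2 + 8 * fmax ^ 2) * CXZα)))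
    -- the estimator
    (k₀ : Fin 3) (βhat : Ω → Fin p' → ℝ)
    (hβhat : ∀ᵐ ω ∂μ,
      (∀ i, kernelSum K h (fun j => Z j ω) (z' i) ≠ 0) →
        ∀ b : Fin p' → ℝ,
          lassoCriterion
            (fun i => Λ (kendallTauEstimator (gStar k₀) K h
              (fun j => X j ω) (fun j => Z j ω) (z' i)))
            (designMatrix ψ z') (γ * t) (βhat ω) ≤
          lassoCriterion
            (fun i => Λ (kendallTauEstimator (gStar k₀) K h
              (fun j => X j ω) (fun j => Z j ω) (z' i)))
            (designMatrix ψ z') (γ * t) b)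
    -- the constants of the probability bound
    (C₁ C₂ C₃ : ℝ)
    (hC₁ : C₁ = fmin ^ 2 / (32 * fmax * (∫ u, K u ^ 2) + (8 / 3) * kernelSup K * fmin))
    (hC₂ : C₂ = (16 * Cψ * CΛ * (fmin ^ 2 + 8 * fmax ^ 2) * fmax * ∫ u, K u ^ 2) ^ 2 / fmin ^ 8)
    (hC₃ : C₃ = (64 / 3) * Cψ * CΛ * kernelSup K ^ 2 * (fmin ^ 2 + 8 * fmax ^ 2) / fmin ^ 4) :
    1 - 2 * (n' : ℝ) * Real.exp (-((n : ℝ) * h ^ p * C₁))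
        - 2 * (n' : ℝ) * Real.exp (-(((n : ℝ) - 1) * h ^ (2 * p) * t ^ 2 / (C₂ + C₃ * t)))
      ≤ μ.real {ω |
          empiricalNorm ((designMatrix ψ z').mulVec (βhat ω - βstar)) ≤
              4 * (γ + 1) * t * Real.sqrt s / restrictedEigenvalue (designMatrix ψ z') s 3 ∧
          ∀ q : ℝ, 1 ≤ q → q ≤ 2 →
            lqNorm q (βhat ω - βstar) ≤
              (4 : ℝ) ^ (2 / q) * (γ + 1) * t * (s : ℝ) ^ (1 / q) /
                restrictedEigenvalue (designMatrix ψ z') s 3 ^ 2} := by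
  -- positivity of the constants
  have hn' : 0 < n' := pos_of_restrictedEigenvalueCondition hRE
  have hfmax0 : 0 < fmax :=
    hfmin_pos.trans_le ((hfmin _ (hz' ⟨0, hn'⟩)).trans (hfmax _))
  have hminmax : fmin ≤ fmax := (hfmin _ (hz' ⟨0, hn'⟩)).trans (hfmax _)
  have hCK := kernelSup_pos hK
  have hI := integral_kernel_sq_pos hK
  have hα! : (0 : ℝ) < α.factorial := by exact_mod_cast α.factorial_pos
  have hCXZ := hfXZ.const_pos
  have hCKα := hfZ.const_pos
  have h0 := hsample.density_nonneg
  have hzpos : ∀ i, 0 < marginalDensity f (z' i) := fun i => hfmin_pos.trans_le (hfmin _ (hz' i))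
  set I := ∫ u, K u ^ 2 with hIdef
  set CK := kernelSup K with hCKdef
  set D := fmin ^ 2 + 8 * fmax ^ 2 with hD
  have hDpos : 0 < D := by positivity
  -- The unit of error for the numerator: the second bandwidth condition says that the smoothing
  -- bias `h ^ α * CXZα / α!` is at most `x`.
  set x := fmin ^ 4 * t / (8 * Cψ * CΛ * D) with hx
  have hxpos : 0 < x := by positivity
  have htx : t = 8 * (Cψ * CΛ) * D * x / fmin ^ 4 := by rw [hx]; field_simp
  set H := h ^ p with hH
  have hH0 : 0 < H := by positivity
  have hpow : h ^ (2 * p) = H ^ 2 := by rw [hH, ← pow_mul, mul_comm]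
  -- the second exponent in terms of `x`
  have he2 : ((n : ℝ) - 1) * h ^ (2 * p) * t ^ 2 / (C₂ + C₃ * t) =
      ((n : ℝ) - 1) * h ^ (2 * p) * x ^ 2 / (4 * (fmax * I) ^ 2 + 8 / 3 * CK ^ 2 * x) := by
    have e1 : C₂ + C₃ * t = 64 * (Cψ * CΛ) ^ 2 * D ^ 2 / fmin ^ 8 *
        (4 * (fmax * I) ^ 2 + 8 / 3 * CK ^ 2 * x) := by
      rw [hC₂, hC₃, htx]; field_simp; ring
    rw [e1, htx]
    field_simp
    ring
  rw [he2, hC₁]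
  set e₂ := ((n : ℝ) - 1) * h ^ (2 * p) * x ^ 2 / (4 * (fmax * I) ^ 2 + 8 / 3 * CK ^ 2 * x)
    with he₂
  have hn'R : (1 : ℝ) ≤ n' := by exact_mod_cast hn'
  -- the bound is trivial unless `n h^{2p} x` is large
  rcases le_or_gt e₂ (1 / 2) with hsmall | hlarge
  · refine le_trans ?_ measureReal_nonneg
    -- Since `n' ≥ 1`, the second exceptional term is then at least one and the left side is not
    -- positive.
    have h1 : 1 / 2 ≤ Real.exp (-e₂) := by
      have := Real.add_one_le_exp (-e₂)
      linarith
    have h2 := Real.exp_pos (-((n : ℝ) * H * (fmin ^ 2 /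
      (32 * fmax * I + 8 / 3 * CK * fmin))))
    have h3 := mul_le_mul_of_nonneg_left h1 (by linarith : (0 : ℝ) ≤ 2 * n')
    have h4 := mul_nonneg (by linarith : (0 : ℝ) ≤ 2 * n') h2.le
    linarith
  have hden : 0 < 4 * (fmax * I) ^ 2 + 8 / 3 * CK ^ 2 * x := by positivity
  -- Dropping the variance part of the denominator, `e₂ > 1 / 2` gives even `4 / 3 * CK ^ 2`. This
  -- forces `n ≥ 2` and makes the diagonal contribution at most `4 x`.
  have hnHx : CK ^ 2 ≤ ((n : ℝ) - 1) * H ^ 2 * x := by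
    rw [he₂, hpow, lt_div_iff₀ hden] at hlarge
    have h1 : x * (4 / 3 * CK ^ 2) ≤ x * (((n : ℝ) - 1) * H ^ 2 * x) := by
      have h2 : 0 ≤ (fmax * I) ^ 2 := sq_nonneg _
      have h3 : x * (((n : ℝ) - 1) * H ^ 2 * x) = ((n : ℝ) - 1) * H ^ 2 * x ^ 2 := by ring
      rw [h3]
      linarith
    have h4 := le_of_mul_le_mul_left h1 hxpos
    have h5 : 0 ≤ CK ^ 2 := sq_nonneg _
    linarith
  have hn1 : (0 : ℝ) < (n : ℝ) - 1 := by
    by_contra hneg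
    have : ((n : ℝ) - 1) * H ^ 2 * x ≤ 0 := by
      rw [mul_assoc]
      exact mul_nonpos_of_nonpos_of_nonneg (not_lt.1 hneg) (by positivity)
    have : 0 < CK ^ 2 := by positivity
    linarith
  have hn2 : 2 ≤ n := by
    have : (1 : ℝ) < n := by linarith
    exact_mod_cast this
  have hn0 : (0 : ℝ) < n := by linarith
  have hdiag : (CK / H) ^ 2 / n ≤ x := by
    rw [div_pow, div_div, div_le_iff₀ (by positivity)]
    have : 0 ≤ H ^ 2 * x := by positivity
    linarith
  have hprob := hsample.isProbabilityMeasure_jointLaw (by omega)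
  have hbias1 : h ^ α / (α.factorial : ℝ) * CKα ≤ fmin / 4 := by
    have := hbandwidth.trans (min_le_left _ _)
    rw [le_div_iff₀ (by positivity)] at this
    rw [div_mul_eq_mul_div, div_le_iff₀ hα!]
    linarith
  have hbias2 : h ^ α / (α.factorial : ℝ) * CXZα ≤ x := by
    have := hbandwidth.trans (min_le_right _ _)
    rw [le_div_iff₀ (by positivity)] at this
    rw [hx, div_mul_eq_mul_div, div_le_div_iff₀ hα! (by positivity)]
    linarith
  -- The `8 x` comes from mean and deviation of the `U`-statistic, the `4 x` from the diagonal. The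
  -- tolerance is `8 D x / fmin ^ 4`, and `D ≥ 9 fmin ^ 2` because `fmin ≤ fmax`.
  have hslack : 4 / fmin ^ 2 * (8 * x + 4 * x) ≤ t / (Cψ * CΛ) := by
    have h1 : t / (Cψ * CΛ) = 8 * D * x / fmin ^ 4 := by rw [htx]; field_simp
    have h2 : 9 * fmin ^ 2 ≤ D := by
      have := pow_le_pow_left₀ hfmin_pos.le hminmax 2
      rw [hD]
      linarith
    rw [h1, div_mul_eq_mul_div, div_le_div_iff₀ (by positivity) (by positivity)]
    have h3 : 0 ≤ fmin ^ 2 * x := by positivity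
    have h4 := mul_le_mul_of_nonneg_right h2 h3
    have h5 : 0 ≤ fmin ^ 4 * x := by positivity
    linarith
  -- the exceptional events
  set A : Fin n' → Set Ω := fun i => {ω | fmin / 4 ≤
    |(1 / (n : ℝ)) * kernelSum K h (fun j => Z j ω) (z' i) -
      ∫ w, scaledKernel K h (w.2 - z' i) ∂(jointLaw f)|} with hA
  set B : Fin n' → Set Ω := fun i => {ω | 4 * x ≤
    |(1 / ((n : ℝ) * (n - 1))) * ∑ q ∈ Finset.univ.offDiag,
        kendallSummand f K h k₀ (z' i) ((X q.1 ω, Z q.1 ω), (X q.2 ω, Z q.2 ω)) -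
        ∫ w, kendallSummand f K h k₀ (z' i) w ∂((jointLaw f).prod (jointLaw f))|} with hB
  have hAbound := measureReal_iUnion_fin_le A fun i =>
    measureReal_kernelSum_le hsample (by omega) hK hh hfmin_pos hfmax0 hfmax (z' i)
  have hBbound := measureReal_iUnion_fin_le B fun i =>
    measureReal_kendallSummand_le hsample hn2 hK hh hfmax0 hfmax (hzpos i) hxpos k₀
  set good := {ω |
          empiricalNorm ((designMatrix ψ z').mulVec (βhat ω - βstar)) ≤
              4 * (γ + 1) * t * Real.sqrt s / restrictedEigenvalue (designMatrix ψ z') s 3 ∧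
          ∀ q : ℝ, 1 ≤ q → q ≤ 2 →
            lqNorm q (βhat ω - βstar) ≤
              (4 : ℝ) ^ (2 / q) * (γ + 1) * t * (s : ℝ) ^ (1 / q) /
                restrictedEigenvalue (designMatrix ψ z') s 3 ^ 2} with hgood
  have hcover : ∀ᵐ ω ∂μ, ω ∈ good ∪ ((⋃ i, A i) ∪ ⋃ i, B i) := by
    filter_upwards [hβhat] with ω hω
    by_contra hnot
    rw [mem_union, mem_union, not_or, not_or] at hnot
    obtain ⟨hng, hnA, hnB⟩ := hnot
    have hnA : ∀ i, |(1 / (n : ℝ)) * kernelSum K h (fun j => Z j ω) (z' i) -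
        ∫ w, scaledKernel K h (w.2 - z' i) ∂(jointLaw f)| < fmin / 4 := fun i => by
      by_contra hc
      exact hnA (mem_iUnion.2 ⟨i, not_lt.1 hc⟩)
    have hnB : ∀ i, |(1 / ((n : ℝ) * (n - 1))) * ∑ q ∈ Finset.univ.offDiag,
        kendallSummand f K h k₀ (z' i) ((X q.1 ω, Z q.1 ω), (X q.2 ω, Z q.2 ω)) -
        ∫ w, kendallSummand f K h k₀ (z' i) w ∂((jointLaw f).prod (jointLaw f))| < 4 * x :=
      fun i => by
        by_contra hc
        exact hnB (mem_iUnion.2 ⟨i, not_lt.1 hc⟩)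
    -- Bias and deviation each cost at most `fmin / 4`. The kernel sums are thus nonzero, so `βhat
    -- ω` is indeed a minimizer.
    have hS : ∀ i, n * (fmin / 2) ≤ kernelSum K h (fun j => Z j ω) (z' i) := by
      intro i
      have h1 := (abs_lt.1 (hnA i)).1
      have h2 := (abs_le.1 (abs_integral_scaledKernel_sub_le hK hh hh1
        hsample.density_measurable h0 hfZ hfmax (hz' i))).1
      have h3 := hfmin _ (hz' i)
      have h4 : fmin / 2 ≤ (1 / (n : ℝ)) * kernelSum K h (fun j => Z j ω) (z' i) := by linarith
      rwa [one_div, le_inv_mul_iff₀ hn0] at h4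
    have hτ : ∀ i, |kendallTauEstimator (gStar k₀) K h (fun j => X j ω) (fun j => Z j ω) (z' i) -
        conditionalKendallTau f (z' i)| ≤ t / (Cψ * CΛ) := by
      intro i
      have h1 := abs_integral_kendallSummand_le hK hh hh1 hsample.density_measurable h0 hfXZ
        (hz' i) (hzpos i) k₀
      have hU : |(1 / ((n : ℝ) * (n - 1))) * ∑ q ∈ Finset.univ.offDiag,
          kendallSummand f K h k₀ (z' i) ((X q.1 ω, Z q.1 ω), (X q.2 ω, Z q.2 ω))| ≤ 8 * x := by
        have h2 := abs_sub_abs_le_abs_sub ((1 / ((n : ℝ) * (n - 1))) *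
          ∑ q ∈ Finset.univ.offDiag, kendallSummand f K h k₀ (z' i)
            ((X q.1 ω, Z q.1 ω), (X q.2 ω, Z q.2 ω)))
          (∫ w, kendallSummand f K h k₀ (z' i) w ∂((jointLaw f).prod (jointLaw f)))
        linarith [hnB i]
      refine (abs_kendallTauEstimator_sub_le hK hh h0 hn2 k₀ _ _ hfmin_pos (hzpos i) (hS i)
        hU).trans (le_trans ?_ hslack)
      rw [mul_div_assoc 4]
      gcongr
    -- The noise correlation is an average of terms bounded by `CΛ * (t / (Cψ * CΛ)) * Cψ = t`.
    refine hng (lasso_oracle_inequality (designMatrix ψ z') _ βstar (βhat ω) hγ ht hs1 hRE hsparse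
      (fun j => average_abs_le hn' fun i => ?_)
      (hω (fun i => ((mul_pos hn0 (half_pos hfmin_pos)).trans_le (hS i)).ne') βstar))
    have h1 := abs_link_sub_le h𝒪 hΛ hΛ' hCΛ.le (hnear _ (hz' i)) (hτ i)
    rw [hmodel _ (hz' i)] at h1
    rw [abs_mul]
    calc _ ≤ CΛ * (t / (Cψ * CΛ)) * Cψ :=
          mul_le_mul h1 (hψ _ (hz' i) j) (abs_nonneg _) (by positivity)
      _ = t := by field_simp
  -- No measurability of `βhat` is assumed, so `good` may fail to be measurable; almost sure
  -- covering and subadditivity of the outer measure suffice.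
  have htotal : 1 ≤ μ.real (good ∪ ((⋃ i, A i) ∪ ⋃ i, B i)) := by
    have h1 : μ.real (univ : Set Ω) = 1 := probReal_univ
    rw [← h1]
    refine (measureReal_congr ?_).le
    exact (ae_eq_univ.2 (ae_iff.1 hcover)).symm
  have h1 := measureReal_union_le (μ := μ) good ((⋃ i, A i) ∪ ⋃ i, B i)
  have h2 := measureReal_union_le (μ := μ) (⋃ i, A i) (⋃ i, B i)
  linarith
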